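/- Let $T$ be a finite forest with at least one edge and let $k\ge 4$ be an integer. The $k$-expansion $T^{(k)}$ is the $k$-uniform hypergraph obtained from $T$ by adding to each edge of $T$ a set of $k-2$ new vertices, the sets added to distinct edges being disjoint; its vertex set consists of $V(T)$ and all the new vertices. Let $\mathrm{ex}(n,T^{(k)})$ be the maximum number of edges in a $k$-uniform hypergraph on $n$ vertices that contains no copy of $T^{(k)}$ as a (not necessarily induced) subhypergraph. Let $$\sigma(T)=\min\{|X|+e(T\setminus X): X\subseteq V(T)\text{ is independent in }T\},$$ where $T\setminus X$ is the forest obtained from $T$ by deleting the vertices of $X$ and the edges incident to them, and $e(\cdot)$ denotes the number of edges. Then, as $n\to\infty$ with $T$ and $k$ fixed, $$\mathrm{ex}(n,T^{(k)})=\bigl(\sigma(T)-1+o(1)\bigr)\binom{n}{k-1}.$$ Moreover, for every $n$ and every set $Y\subseteq[n]$ with $|Y|=\sigma(T)-1$, the hypergraph of all $k$-sets $E\subseteq[n]$ with $|E\cap Y|=1$ contains no copy of $T^{(k)}$, and it has $(\sigma(T)-1)\binom{n-\sigma(T)+1}{k-1}$ edges; hence $\mathrm{ex}(n,T^{(k)})\ge(\sigma(T)-1)\binom{n-\sigma(T)+1}{k-1}$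 whenever $n\ge\sigma(T)-1$. -/

import Mathlib

open Filter Asymptotics

/-!
A (hyper)graph with vertex set the whole type `W` is identified with its family of edges, a
collection of finite subsets of `W`.
-/

/-- The edge of the `k`-expansion that replaces the edge `e = xy` of the graph `T`: the two
endpoints `x, y`, together with the `k - 2` new vertices `(e, i)`, `i < k - 2`, that belong to this
edge only. -/
noncomputable def expansionEdge {V : Type*} (T : SimpleGraph V) (k : ℕ) (e : T.edgeSet) :
    Finset (V ⊕ T.edgeSet × Fin (k - 2)) :=
  open Classical in (e : Sym2 V).toFinset.disjSum ({e} ×ˢ Finset.univ)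

/-- The `k`-expansion `T^(k)` of a graph `T`. Its vertex set is the whole type
`V ⊕ T.edgeSet × Fin (k - 2)`, that is, the vertices of `T` and `k - 2` new vertices for each
edge of `T`. -/
def kExpansion {V : Type*} (T : SimpleGraph V) (k : ℕ) :
    Set (Finset (V ⊕ T.edgeSet × Fin (k - 2))) :=
  Set.range (expansionEdge T k)

/-- The hypergraph `F` with vertex set `U` contains a copy of the hypergraph `H` with vertex
set `W` (as a not necessarily induced subhypergraph). -/
def ContainsCopy {U W : Type*} (F : Finset (Finset U)) (H : Set (Finset W)) : Prop :=
  ∃ f : W ↪ U, ∀ e ∈ H, e.map f ∈ F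

/-- The `k`-uniform Turán number `ex_k(n, H)`: the maximum number of edges in a `k`-uniform
hypergraph on the vertex set `Fin n` that does not contain a copy of `H`. -/
noncomputable def hypergraphTuranNumber (k n : ℕ) {W : Type*} (H : Set (Finset W)) : ℕ :=
  open Classical in
  (Finset.univ.filter fun F : Finset (Finset (Fin n)) =>
    (F : Set (Finset (Fin n))).Sized k ∧ ¬ ContainsCopy F H).sup Finset.card

/-- `σ(T)`, the minimum of `|X| + e(T ∖ X)` over the independent vertex sets `X` of the finite
graph `T`, where `T ∖ X` is the graph left after deleting the vertices of `X`. -/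
noncomputable def forestSigma {V : Type*} [Fintype V] (T : SimpleGraph V) : ℕ :=
  sInf {m : ℕ | ∃ X : Finset V, T.IsIndepSet (X : Set V) ∧
    m = X.card + (T.induce ((X : Set V)ᶜ)).edgeSet.ncard}

/-- The `k`-uniform hypergraph on `Fin n` whose edges are all the `k`-sets that meet `Y` in exactly
one vertex. -/
def crossCutFamily (k n : ℕ) (Y : Finset (Fin n)) : Finset (Finset (Fin n)) :=
  (Finset.univ.powersetCard k).filter fun E => (E ∩ Y).card = 1

/-!
The lower bound is a counting remark: if the family of `k`-sets meeting `Y` in one vertex contained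
the expansion `T^(k)`, the vertices of `T` mapped into `Y` would form an independent set `X`, and
each edge of `T ∖ X` would use a new vertex mapped into `Y`, so that
`|Y| ≥ |X| + e(T ∖ X) ≥ σ(T)`.

For the upper bound let `F` be a `k`-uniform family on `n` points without `T^(k)`. Call a set `K`
*robust* in `F` if for every set `Z` of at most `m` points some edge of `F` contains `K` and avoids
`Z ∖ K`; here `m` is a constant depending on `T` and `k`. If the graph `G` of robust pairs contained
`T`, then its edges could be expanded one after the other, giving a copy of `T^(k)`
(`containsCopy_of_embedding_robustGraph`). So `G` does not contain the forest `T`, and therefore it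
has `O(n)` edges (`sum_degree_le_of_no_embedding`).

On the other hand, all but `O(n ^ (k - 2))` edges of `F` span in `G` either a spanning star or two
disjoint edges (`card_le_of_forall_not_spans`). This is where the delta-system method enters.
Colour the points with `k` colours and keep the rainbow edges; the trace of an edge on a set `I` of
colours has one point of each colour in `I`. A family loses only a constant factor on passing to a
homogeneous subfamily, in which for each `I` either all traces on `I` are robust, or no two edges meet exactly
in a common trace on `I` (`exists_homogeneous`). In a homogeneous family the robust `I` are closed
under intersection, and if the family has more than `n ^ (k - 2)` edges then every set of `k - 2`
colours lies in a robust proper subset. Such a set system on at least four points contains all the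
pairs through some point, or two disjoint pairs (`exists_star_or_two_pairs`).

It remains to count. Since `G` has `O(n)` edges, only `O(n ^ (k - 2))` edges of `F` contain two
disjoint edges of `G`, and at most `O(n ^ (k - 1) / q)` contain a spanning star whose centre has
degree at most `n / q`. The set `L` of vertices of degree greater than `n / q` has bounded size, so
that up to `O(n ^ (k - 2))` exceptions the other edges meet `L` in exactly one point. If a set
`Y ⊆ L` of `σ(T)` points had a common link of more than `m n ^ (k - 2)` sets, the link would contain
a full subfamily, that is, one in which each point of each member can be exchanged in many ways;
every small linear forest embeds there, and mapping `X` and one new vertex of each edge of `T ∖ X`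
to `Y` would give a copy of `T^(k)` (`containsCopy_of_isFull_link`). Hence all but `O(n ^ (k - 2))`
of the `(k - 1)`-sets outside `L` are completed to an edge by at most `σ(T) - 1` points of `L`, and
`|F| ≤ (σ(T) - 1) * n.choose (k - 1) + O(n ^ (k - 1) / q) + O_q(n ^ (k - 2))` for every `q`.
-/

/-! ### Rainbow subfamilies and homogeneous subfamilies -/

/-- The trace of `E` on a set `I` of colours: the points of `E` whose colour lies in `I`. -/
def colorTrace {α κ : Type*} [DecidableEq κ] (c : α → κ) (I : Finset κ) (E : Finset α) :
    Finset α :=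
  E.filter fun z => c z ∈ I

/-- Every trace on `I` of an edge of `F` is robust in `F`: whichever `m` points are forbidden, there
is an edge with the same trace that avoids them outside the colours in `I`. -/
def RobustType {α κ : Type*} [DecidableEq κ] (c : α → κ) (m : ℕ) (F : Finset (Finset α))
    (I : Finset κ) : Prop :=
  ∀ E ∈ F, ∀ Z : Finset α, Z.card ≤ m →
    ∃ E' ∈ F, colorTrace c I E' = colorTrace c I E ∧ ∀ z ∈ E', z ∈ Z → c z ∈ I

/-- No two edges of `F` meet exactly in a common trace on `I`: if two traces on `I` agree, the edges
share a further point. This includes the case of twice the same edge, which excludes that all the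
colours of an edge lie in `I`. -/
def AvoidedType {α κ : Type*} [DecidableEq κ] (c : α → κ) (F : Finset (Finset α))
    (I : Finset κ) : Prop :=
  ∀ E ∈ F, ∀ E' ∈ F, colorTrace c I E = colorTrace c I E' → ∃ z ∈ E, z ∈ E' ∧ c z ∉ I

theorem AvoidedType.mono {α κ : Type*} [DecidableEq κ] {c : α → κ} {F F' : Finset (Finset α)}
    {I : Finset κ} (h : AvoidedType c F I) (hF : F' ⊆ F) : AvoidedType c F' I :=
  fun E hE E' hE' => h E (hF hE) E' (hF hE')

theorem exists_popular_element {α : Type*} [DecidableEq α] {m : ℕ} (F : Finset (Finset α))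
    (hF : F.Nonempty) (Z : Finset α) (hZ : Z.card ≤ m) (h : ∀ E ∈ F, ∃ z ∈ E, z ∈ Z) :
    ∃ z ∈ Z, F.card ≤ m * (F.filter fun E => z ∈ E).card := by
  obtain ⟨E, hE⟩ := hF
  obtain ⟨z₀, -, hz₀⟩ := h E hE
  obtain ⟨z, hz, hmax⟩ := Z.exists_max_image (fun z => (F.filter fun E => z ∈ E).card) ⟨z₀, hz₀⟩
  refine ⟨z, hz, ?_⟩
  have hsub : F ⊆ Z.biUnion fun z => F.filter fun E => z ∈ E := by
    intro E hE
    obtain ⟨z, h1, h2⟩ := h E hE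
    simp only [Finset.mem_biUnion, Finset.mem_filter]
    exact ⟨z, h2, hE, h1⟩
  calc F.card ≤ _ := Finset.card_le_card hsub
    _ ≤ Z.card * _ := Finset.card_biUnion_le_card_mul _ _ _ hmax
    _ ≤ _ := Nat.mul_le_mul_right _ hZ

/-- Repeatedly remove from `F` all the edges with some non-robust trace `K` on some `I ∈ U`. What is
left in the end is `F₀`. The edges removed with `K` all meet a set of `m` points outside the colours
in `I`, so a proportion `1 / m` of them shares such a point; these are collected in `D I`. -/
theorem exists_robust_subfamily_add_avoided {α κ : Type*} [DecidableEq α] [DecidableEq κ]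
    (c : α → κ) (m : ℕ) (U : Finset (Finset κ)) (F : Finset (Finset α)) :
    ∃ F₀ ⊆ F, (∀ I ∈ U, RobustType c m F₀ I) ∧ ∃ D : Finset κ → Finset (Finset α),
      (∀ I, D I ⊆ F ∧ AvoidedType c (D I) I) ∧
      F.card ≤ F₀.card + m * ∑ I ∈ U, (D I).card := by
  induction F using Finset.strongInduction with
  | H F ih =>
  by_cases hF : ∀ I ∈ U, RobustType c m F I
  · exact ⟨F, subset_rfl, hF, fun _ => ∅, fun I => ⟨Finset.empty_subset _, by simp [AvoidedType]⟩,
      by simp⟩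
  unfold RobustType at hF
  push Not at hF
  obtain ⟨I, hI, E, hE, Z, hZ, hbad⟩ := hF
  set K := colorTrace c I E with hK
  set A := F.filter fun E' => colorTrace c I E' = K with hA
  have hAF : A ⊆ F := Finset.filter_subset _ _
  have hEA : E ∈ A := by simp [hA, hE, hK]
  obtain ⟨z, hzZ, hz⟩ := exists_popular_element A ⟨E, hEA⟩ (Z.filter fun z => c z ∉ I)
    ((Finset.card_filter_le _ _).trans hZ) (by
      intro E' hE'
      rw [hA, Finset.mem_filter] at hE'
      obtain ⟨z, h1, h2, h3⟩ := hbad E' hE'.1 hE'.2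
      exact ⟨z, h1, Finset.mem_filter.2 ⟨h2, h3⟩⟩)
  have hzI : c z ∉ I := (Finset.mem_filter.1 hzZ).2
  obtain ⟨F₀, hF₀, hrob, D, hD, hcard⟩ := ih (F \ A)
    (Finset.sdiff_ssubset hAF ⟨E, hEA⟩)
  set B := A.filter fun E' => z ∈ E' with hB
  refine ⟨F₀, hF₀.trans Finset.sdiff_subset, hrob, Function.update D I (D I ∪ B), ?_, ?_⟩
  · intro J
    by_cases hJ : J = I
    · subst hJ
      rw [Function.update_self]
      refine ⟨Finset.union_subset ((hD J).1.trans Finset.sdiff_subset)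
        ((Finset.filter_subset _ _).trans hAF), ?_⟩
      have hDK : ∀ E' ∈ D J, colorTrace c J E' ≠ K := by
        intro E' hE' h
        have := (hD J).1 hE'
        rw [Finset.mem_sdiff] at this
        exact this.2 (Finset.mem_filter.2 ⟨this.1, h⟩)
      have hBK : ∀ E' ∈ B, colorTrace c J E' = K ∧ z ∈ E' := by
        intro E' hE'
        simp only [hB, hA, Finset.mem_filter] at hE'
        exact ⟨hE'.1.2, hE'.2⟩
      intro E₁ h₁ E₂ h₂ h
      rcases Finset.mem_union.1 h₁ with h₁ | h₁ <;> rcases Finset.mem_union.1 h₂ with h₂ | h₂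
      · exact (hD J).2 _ h₁ _ h₂ h
      · exact absurd (h.trans (hBK _ h₂).1) (hDK _ h₁)
      · exact absurd (h.symm.trans (hBK _ h₁).1) (hDK _ h₂)
      · exact ⟨z, (hBK _ h₁).2, (hBK _ h₂).2, hzI⟩
    · rw [Function.update_of_ne hJ]
      exact ⟨(hD J).1.trans Finset.sdiff_subset, (hD J).2⟩
  · have h1 : F.card = (F \ A).card + A.card := (Finset.card_sdiff_add_card_eq_card hAF).symm
    have h2 : (D I ∪ B).card = (D I).card + B.card := by
      apply Finset.card_union_of_disjoint
      rw [Finset.disjoint_left]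
      intro E' h h'
      have := (hD I).1 h
      rw [Finset.mem_sdiff] at this
      exact this.2 (Finset.mem_filter.1 h').1
    have h3 : ∑ J ∈ U, (Function.update D I (D I ∪ B) J).card
        = ∑ J ∈ U, (D J).card + B.card := by
      rw [← Finset.add_sum_erase _ _ hI, ← Finset.add_sum_erase U (fun J => (D J).card) hI,
        Function.update_self, h2]
      have : ∑ J ∈ U.erase I, (Function.update D I (D I ∪ B) J).card
          = ∑ J ∈ U.erase I, (D J).card :=
        Finset.sum_congr rfl fun J hJ => by
          rw [Function.update_of_ne (Finset.ne_of_mem_erase hJ)]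
      omega
    rw [h3, h1, mul_add]
    omega

/-- Here `U` is the set of types that are not yet known to be avoided. Either a constant proportion
of the family is robust for all of them, or a constant proportion avoids a new type. -/
theorem exists_homogeneous_of_avoided {α κ : Type*} [DecidableEq α] [DecidableEq κ] [Fintype κ]
    (c : α → κ) (m : ℕ) (U : Finset (Finset κ)) (F : Finset (Finset α))
    (hU : ∀ I ∉ U, AvoidedType c F I) :
    ∃ F' ⊆ F, F.card ≤ (1 + m * Fintype.card (Finset κ)) ^ U.card * F'.card ∧
      ∀ I, RobustType c m F' I ∨ AvoidedType c F' I := by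
  induction hu : U.card generalizing U F with
  | zero =>
    rw [Finset.card_eq_zero] at hu
    subst hu
    exact ⟨F, subset_rfl, by simp, fun I => Or.inr (hU I (Finset.notMem_empty I))⟩
  | succ u ih =>
    obtain ⟨F₀, hF₀, hrob, D, hD, hcard⟩ := exists_robust_subfamily_add_avoided c m U F
    set N := 1 + m * Fintype.card (Finset κ) with hN
    by_cases h : F.card ≤ N * F₀.card
    · refine ⟨F₀, hF₀, h.trans (Nat.mul_le_mul_right _ ?_), fun I => ?_⟩
      · exact Nat.le_self_pow (by omega) _
      · by_cases hI : I ∈ U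
        · exact Or.inl (hrob I hI)
        · exact Or.inr ((hU I hI).mono hF₀)
    · have : ∃ I ∈ U, F.card ≤ N * (D I).card := by
        by_contra! hcon
        have h1 : N * ∑ I ∈ U, (D I).card ≤ U.card * F.card := by
          rw [Finset.mul_sum]
          exact (Finset.sum_le_card_nsmul _ _ _ fun I hI => (hcon I hI).le).trans (by simp)
        have h2 : U.card ≤ Fintype.card (Finset κ) := Finset.card_le_univ U
        have h3 : N * F.card ≤ N * F₀.card + m * (U.card * F.card) := by
          calc N * F.card ≤ N * (F₀.card + m * ∑ I ∈ U, (D I).card) := Nat.mul_le_mul_left _ hcard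
            _ = N * F₀.card + m * (N * ∑ I ∈ U, (D I).card) := by ring
            _ ≤ _ := by gcongr
        have h4 : m * (U.card * F.card) ≤ m * Fintype.card (Finset κ) * F.card := by
          rw [mul_assoc]; gcongr
        have h5 : N * F.card = F.card + m * Fintype.card (Finset κ) * F.card := by
          rw [hN]; ring
        omega
      obtain ⟨I, hI, hFI⟩ := this
      obtain ⟨F', hF', hc, hhom⟩ := ih (U.erase I) (D I) (by
        intro J hJ
        by_cases hJI : J = I
        · exact hJI ▸ (hD I).2
        · exact (hU J fun h => hJ (Finset.mem_erase.2 ⟨hJI, h⟩)).mono (hD I).1)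
        (by rw [Finset.card_erase_of_mem hI]; omega)
      refine ⟨F', hF'.trans (hD I).1, ?_, hhom⟩
      calc F.card ≤ N * (D I).card := hFI
        _ ≤ N * (N ^ u * F'.card) := Nat.mul_le_mul_left _ hc
        _ = _ := by ring

/-- Homogeneity, in the manner of Füredi's theorem on delta-systems: at the cost of a constant
factor every type is robust or avoided. -/
theorem exists_homogeneous {α κ : Type*} [DecidableEq α] [DecidableEq κ] [Fintype κ]
    (c : α → κ) (m : ℕ) (F : Finset (Finset α)) :
    ∃ F' ⊆ F, F.card ≤
        (1 + m * Fintype.card (Finset κ)) ^ Fintype.card (Finset κ) * F'.card ∧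
      ∀ I, RobustType c m F' I ∨ AvoidedType c F' I :=
  exists_homogeneous_of_avoided c m Finset.univ F fun I h => absurd (Finset.mem_univ I) h

open Classical in
/-- Averaging over all colourings with `k` colours: a `k`-set is rainbow for at least a proportion
`1 / k ^ k` of them. -/
theorem exists_rainbow_coloring {α : Type*} [Fintype α] {k : ℕ} (hk : 0 < k)
    (F : Finset (Finset α)) (hF : (F : Set (Finset α)).Sized k) :
    ∃ c : α → Fin k,
      F.card ≤ k ^ k * (F.filter fun E : Finset α => Set.InjOn c (E : Set α)).card := by
  have : Nonempty (Fin k) := ⟨⟨0, hk⟩⟩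
  have key : ∀ E ∈ F, Fintype.card (α → Fin k) ≤
      k ^ k * (Finset.univ.filter fun c : α → Fin k => Set.InjOn c (E : Set α)).card := by
    intro E hE
    have hcE : E.card = k := hF hE
    let e : E ≃ Fin k := E.equivFinOfCardEq hcE
    -- Overwrite a colouring on `E` by a fixed bijection, and remember its old values on `E`.
    let g : (α → Fin k) → (E → Fin k) × (α → Fin k) := fun c =>
      (fun x => c x, fun a => if h : a ∈ E then e ⟨a, h⟩ else c a)
    have hg : Function.Injective g := by
      intro c c' h
      simp only [g, Prod.mk.injEq] at h
      funext a
      by_cases ha : a ∈ E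
      · exact congrFun h.1 ⟨a, ha⟩
      · have := congrFun h.2 a
        simpa [ha] using this
    have hmaps : ∀ c ∈ (Finset.univ : Finset (α → Fin k)), g c ∈
        (Finset.univ : Finset (E → Fin k)) ×ˢ
          (Finset.univ.filter fun c : α → Fin k => Set.InjOn c (E : Set α)) := by
      intro c _
      simp only [Finset.mem_product, Finset.mem_univ, true_and, Finset.mem_filter, g]
      intro a ha b hb hab
      have ha' : a ∈ E := ha
      have hb' : b ∈ E := hb
      simp only [ha', hb', dif_pos] at hab
      exact congrArg Subtype.val (e.injective hab)
    have := Finset.card_le_card_of_injOn g hmaps hg.injOn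
    rw [Finset.card_product] at this
    simpa [hcE] using this
  by_contra! hcon
  have h1 : ∑ c : α → Fin k, (F.filter fun E : Finset α => Set.InjOn c (E : Set α)).card
      = ∑ E ∈ F, (Finset.univ.filter fun c : α → Fin k => Set.InjOn c (E : Set α)).card :=
    Finset.sum_card_bipartiteAbove_eq_sum_card_bipartiteBelow
      (fun (c : α → Fin k) (E : Finset α) => Set.InjOn c (E : Set α))
  have h2 : F.card * Fintype.card (α → Fin k) ≤
      k ^ k * ∑ c : α → Fin k, (F.filter fun E : Finset α => Set.InjOn c (E : Set α)).card := by
    rw [h1, Finset.mul_sum, ← smul_eq_mul]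
    exact Finset.card_nsmul_le_sum _ _ _ key
  have h3 : k ^ k * ∑ c : α → Fin k, (F.filter fun E : Finset α => Set.InjOn c (E : Set α)).card
      < ∑ c : α → Fin k, F.card := by
    rw [Finset.mul_sum]
    exact Finset.sum_lt_sum_of_nonempty Finset.univ_nonempty fun c _ => hcon c
  rw [Finset.sum_const, smul_eq_mul, Finset.card_univ] at h3
  exact absurd (h3.trans_le (mul_comm _ _).le) h2.not_gt

/-! ### The graph of robust pairs spanned by an edge -/

/-- `K` is robust in `F`: whichever `m` points are forbidden, there is an edge of `F` that contains
`K` and avoids these points outside `K`. This is the property of the kernels of large sunflowers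
that is needed to build copies greedily. -/
def RobustKernel {α : Type*} (m : ℕ) (F : Finset (Finset α)) (K : Finset α) : Prop :=
  ∀ Z : Finset α, Z.card ≤ m → ∃ E ∈ F, K ⊆ E ∧ ∀ z ∈ E, z ∈ Z → z ∈ K

theorem RobustKernel.mono {α : Type*} {m : ℕ} {F F' : Finset (Finset α)} {K : Finset α}
    (h : RobustKernel m F K) (hF : F ⊆ F') : RobustKernel m F' K := fun Z hZ =>
  let ⟨E, hE, h'⟩ := h Z hZ
  ⟨E, hF hE, h'⟩

/-- The graph of the pairs of points that are robust in `F`. -/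
def robustGraph {α : Type*} [DecidableEq α] (m : ℕ) (F : Finset (Finset α)) : SimpleGraph α where
  Adj x y := x ≠ y ∧ RobustKernel m F {x, y}
  symm := ⟨fun x y h => ⟨h.1.symm, by rw [Finset.pair_comm]; exact h.2⟩⟩
  loopless := ⟨fun _ h => h.1 rfl⟩

theorem robustGraph_mono {α : Type*} [DecidableEq α] {m : ℕ} {F F' : Finset (Finset α)}
    (hF : F ⊆ F') : robustGraph m F ≤ robustGraph m F' := fun _ _ h => ⟨h.1, h.2.mono hF⟩

/-- In the graph `G`, some point of `E` is adjacent to all the others. -/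
def SpansStar {α : Type*} (G : SimpleGraph α) (E : Finset α) : Prop :=
  ∃ x ∈ E, ∀ y ∈ E, y ≠ x → G.Adj x y

/-- The set `E` contains two disjoint edges of the graph `G`. -/
def SpansTwoEdges {α : Type*} (G : SimpleGraph α) (E : Finset α) : Prop :=
  ∃ a ∈ E, ∃ b ∈ E, ∃ c ∈ E, ∃ d ∈ E, a ≠ c ∧ a ≠ d ∧ b ≠ c ∧ b ≠ d ∧ G.Adj a b ∧ G.Adj c d

theorem SpansStar.mono {α : Type*} {G G' : SimpleGraph α} {E : Finset α} (h : SpansStar G E)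
    (hG : G ≤ G') : SpansStar G' E :=
  let ⟨x, hx, h'⟩ := h
  ⟨x, hx, fun y hy hyx => hG (h' y hy hyx)⟩

theorem SpansTwoEdges.mono {α : Type*} {G G' : SimpleGraph α} {E : Finset α}
    (h : SpansTwoEdges G E) (hG : G ≤ G') : SpansTwoEdges G' E :=
  let ⟨a, ha, b, hb, c, hc, d, hd, h1, h2, h3, h4, h5, h6⟩ := h
  ⟨a, ha, b, hb, c, hc, d, hd, h1, h2, h3, h4, hG h5, hG h6⟩

section Types

variable {κ : Type*} [DecidableEq κ] [Fintype κ]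

/-- In terms of complements `J` is closed under unions. It contains the complements of the
singletons outside `M` by definition of `M`, and the covering hypothesis forces the complements of
the pairs in `M`; a nonempty set `S` with `|S ∩ M| ≠ 1` is a union of such singletons and pairs. -/
theorem compl_mem_of_card_inter_ne_one {J : Set (Finset κ)}
    (hinter : ∀ I ∈ J, ∀ I' ∈ J, I ∩ I' ∈ J)
    (hcover : ∀ i j, i ≠ j → ∃ I ∈ J, I ≠ Finset.univ ∧ ({i, j}ᶜ : Finset κ) ⊆ I)
    {M : Finset κ} (hM : ∀ i, i ∈ M ↔ ({i}ᶜ : Finset κ) ∉ J)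
    {S : Finset κ} (hS : S.Nonempty) (hSM : (S ∩ M).card ≠ 1) : Sᶜ ∈ J := by
  -- A proper superset of `{i, j}ᶜ` is `{i, j}ᶜ`, `{i}ᶜ` or `{j}ᶜ`, and the last two are not in `J`.
  have hpair : ∀ i ∈ M, ∀ j ∈ M, i ≠ j → ({i, j}ᶜ : Finset κ) ∈ J := by
    intro i hi j hj hij
    obtain ⟨I, hI, hIu, hsub⟩ := hcover i j hij
    have hsub' : Iᶜ ⊆ {i, j} := by
      rw [← Finset.compl_subset_compl, compl_compl]; exact hsub
    have hne : Iᶜ ≠ ∅ := by simpa using hIu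
    have hnot : ∀ l ∈ M, Iᶜ ≠ {l} := by
      intro l hl h
      apply (hM l).1 hl
      rw [← h, compl_compl]
      exact hI
    have : Iᶜ = {i, j} := by
      refine Finset.Subset.antisymm hsub' ?_
      rcases Finset.eq_empty_or_nonempty Iᶜ with h | ⟨l, hl⟩
      · exact absurd h hne
      · have h1 : i ∈ Iᶜ := by
          by_contra hi'
          apply hnot j hj
          ext x
          constructor
          · intro hx
            rcases Finset.mem_insert.1 (hsub' hx) with rfl | h
            · exact absurd hx hi'
            · exact h
          · intro hx
            rw [Finset.mem_singleton] at hx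
            subst hx
            rcases Finset.mem_insert.1 (hsub' hl) with rfl | h
            · exact absurd hl hi'
            · rw [Finset.mem_singleton] at h; exact h ▸ hl
        have h2 : j ∈ Iᶜ := by
          by_contra hj'
          apply hnot i hi
          ext x
          constructor
          · intro hx
            rcases Finset.mem_insert.1 (hsub' hx) with rfl | h
            · exact Finset.mem_singleton_self _
            · rw [Finset.mem_singleton] at h; exact absurd (h ▸ hx) hj'
          · intro hx
            rw [Finset.mem_singleton] at hx
            exact hx ▸ h1
        intro x hx
        rcases Finset.mem_insert.1 hx with rfl | h
        · exact h1
        · rw [Finset.mem_singleton] at h; exact h ▸ h2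
    rw [← this, compl_compl]
    exact hI
  have hloc : ∀ s, ∃ R : Finset κ, s ∈ S → s ∈ R ∧ R ⊆ S ∧ Rᶜ ∈ J := by
    intro s
    by_cases hs : s ∈ S
    · by_cases hsM : s ∈ M
      · have h1 : 0 < (S ∩ M).card := Finset.card_pos.2 ⟨s, Finset.mem_inter.2 ⟨hs, hsM⟩⟩
        obtain ⟨t, ht, hts⟩ := Finset.exists_mem_ne (by omega : 1 < (S ∩ M).card) s
        rw [Finset.mem_inter] at ht
        refine ⟨{s, t}, fun _ => ⟨by simp, ?_, hpair s hsM t ht.2 hts.symm⟩⟩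
        intro x hx
        rcases Finset.mem_insert.1 hx with rfl | h
        · exact hs
        · rw [Finset.mem_singleton] at h; exact h ▸ ht.1
      · refine ⟨{s}, fun _ => ⟨by simp, by simpa using hs, ?_⟩⟩
        by_contra h
        exact hsM ((hM s).2 h)
    · exact ⟨∅, fun h => absurd h hs⟩
  choose R hR using hloc
  have hmem : S.inf' hS (fun s => (R s)ᶜ) ∈ J :=
    Finset.inf'_mem J (fun x hx y hy => hinter x hx y hy) _ _ _ fun s hs => (hR s hs).2.2
  convert hmem using 1
  apply le_antisymm
  · exact Finset.le_inf' _ _ fun s hs => Finset.compl_subset_compl.2 (hR s hs).2.1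
  · intro x hx
    rw [Finset.mem_compl]
    intro hxS
    have := (Finset.inf'_le (fun s => (R s)ᶜ) hxS : S.inf' hS (fun s => (R s)ᶜ) ≤ (R x)ᶜ) hx
    rw [Finset.mem_compl] at this
    exact this (hR x hxS).1

/-- The distinction is by the number of missing co-singletons, the set `M` of the proof. If `|M| =
2`, then `J` contains the pair `M` and every pair outside `M`, and the latter exist because there
are at least four points. In all other cases `J` contains all the pairs through some point. -/
theorem exists_star_or_two_pairs (hκ : 4 ≤ Fintype.card κ) {J : Set (Finset κ)}
    (hinter : ∀ I ∈ J, ∀ I' ∈ J, I ∩ I' ∈ J)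
    (hcover : ∀ i j, i ≠ j → ∃ I ∈ J, I ≠ Finset.univ ∧ ({i, j}ᶜ : Finset κ) ⊆ I) :
    (∃ v : κ, ∀ w, w ≠ v → {v, w} ∈ J) ∨
      ∃ a b c d : κ, a ≠ b ∧ c ≠ d ∧ a ≠ c ∧ a ≠ d ∧ b ≠ c ∧ b ≠ d ∧ {a, b} ∈ J ∧ {c, d} ∈ J := by
  classical
  set M : Finset κ := Finset.univ.filter fun i => ({i}ᶜ : Finset κ) ∉ J with hMdef
  have hM : ∀ i, i ∈ M ↔ ({i}ᶜ : Finset κ) ∉ J := by simp [hMdef]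
  have key : ∀ v w : κ, (M \ {v, w}).card ≠ 1 → ({v, w} : Finset κ) ∈ J := by
    intro v w h
    have h2 : ({v, w} : Finset κ).card ≤ 2 := Finset.card_le_two
    have hne : ({v, w}ᶜ : Finset κ).Nonempty := by
      rw [← Finset.card_pos, Finset.card_compl]; omega
    have := compl_mem_of_card_inter_ne_one hinter hcover hM hne (by
      rwa [Finset.inter_comm, ← Finset.sdiff_eq_inter_compl])
    rwa [compl_compl] at this
  have hlow : ∀ v w : κ, M.card - 2 ≤ (M \ {v, w}).card := by
    intro v w
    have h2 : ({v, w} : Finset κ).card ≤ 2 := Finset.card_le_two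
    have := Finset.le_card_sdiff {v, w} M
    omega
  rcases Nat.lt_or_ge M.card 2 with h | h
  · left
    have hne : Nonempty κ := Fintype.card_pos_iff.1 (by omega)
    obtain ⟨x, hx⟩ : ∃ x, M ⊆ {x} := by
      rcases Finset.eq_empty_or_nonempty M with h0 | ⟨x, hx⟩
      · exact ⟨Classical.arbitrary κ, by simp [h0]⟩
      · refine ⟨x, fun y hy => ?_⟩
        rw [Finset.mem_singleton]
        exact Finset.card_le_one.1 (by omega) _ hy _ hx
    refine ⟨x, fun w _ => key x w ?_⟩
    have : M \ {x, w} = ∅ := by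
      rw [Finset.sdiff_eq_empty_iff_subset]
      exact hx.trans (by simp)
    simp [this]
  · rcases h.eq_or_lt with h | h
    · right
      obtain ⟨a, b, hab, hMab⟩ := Finset.card_eq_two.1 h.symm
      have : 1 < ({a, b}ᶜ : Finset κ).card := by
        rw [Finset.card_compl, ← hMab]; omega
      obtain ⟨c, hc, d, hd, hcd⟩ := Finset.one_lt_card.1 this
      simp only [Finset.mem_compl, Finset.mem_insert, Finset.mem_singleton, not_or] at hc hd
      refine ⟨a, b, c, d, hab, hcd, Ne.symm hc.1, Ne.symm hd.1, Ne.symm hc.2, Ne.symm hd.2,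
        key a b ?_, key c d ?_⟩
      · simp [hMab]
      · have : M \ {c, d} = M := by
          rw [Finset.sdiff_eq_self_iff_disjoint, hMab, Finset.disjoint_left]
          intro x hx
          simp only [Finset.mem_insert, Finset.mem_singleton] at hx ⊢
          rcases hx with rfl | rfl
          · exact fun h => h.elim (fun h => hc.1 h.symm) fun h => hd.1 h.symm
          · exact fun h => h.elim (fun h => hc.2 h.symm) fun h => hd.2 h.symm
        rw [this]; omega
    · left
      by_cases hMu : M = Finset.univ
      · have hne : Nonempty κ := Fintype.card_pos_iff.1 (by omega)
        refine ⟨Classical.arbitrary κ, fun w _ => key _ w ?_⟩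
        have h1 := hlow (Classical.arbitrary κ) w
        have h2 : M.card = Fintype.card κ := by rw [hMu, Finset.card_univ]
        omega
      · obtain ⟨v, hv⟩ : ∃ v, v ∉ M := by
          by_contra! hcon
          exact hMu (Finset.eq_univ_iff_forall.2 hcon)
        refine ⟨v, fun w _ => key v w ?_⟩
        have : M \ {v, w} = M \ {w} := by
          ext x
          simp only [Finset.mem_sdiff, Finset.mem_insert, Finset.mem_singleton, not_or]
          refine ⟨fun h => ⟨h.1, h.2.2⟩, fun h => ⟨h.1, fun hx => hv (hx ▸ h.1), h.2⟩⟩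
        rw [this]
        have := Finset.le_card_sdiff {w} M
        rw [Finset.card_singleton] at this
        omega

end Types

section Homogeneous

variable {α κ : Type*} [DecidableEq κ] {c : α → κ} {m : ℕ} {F : Finset (Finset α)}

theorem mem_colorTrace {I : Finset κ} {E : Finset α} {z : α} :
    z ∈ colorTrace c I E ↔ z ∈ E ∧ c z ∈ I := by
  simp [colorTrace]

theorem colorTrace_inter (I I' : Finset κ) (E : Finset α) :
    colorTrace c (I ∩ I') E = colorTrace c I' (colorTrace c I E) := by
  ext z
  simp only [mem_colorTrace, Finset.mem_inter, and_assoc]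

/-- By homogeneity it is enough that `I ∩ I'` is not avoided. From an edge `E` one passes to `E₁`
with the same trace on `I` and then to `E₂` with the trace of `E₁` on `I'`, both times avoiding `E`
otherwise, and then `E` and `E₂` meet exactly in their common trace on `I ∩ I'`. -/
theorem RobustType.inter (hm : ∀ E ∈ F, E.card ≤ m) (hne : F.Nonempty)
    (hhom : ∀ I, RobustType c m F I ∨ AvoidedType c F I) {I I' : Finset κ}
    (hI : RobustType c m F I) (hI' : RobustType c m F I') : RobustType c m F (I ∩ I') := by
  refine (hhom _).resolve_right fun hav => ?_
  obtain ⟨E, hE⟩ := hne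
  obtain ⟨E₁, hE₁, h₁, hz₁⟩ := hI E hE E (hm E hE)
  obtain ⟨E₂, hE₂, h₂, hz₂⟩ := hI' E₁ hE₁ E (hm E hE)
  obtain ⟨z, hz, hz', hzI⟩ := hav E hE E₂ hE₂ (by
    rw [colorTrace_inter, ← h₁, ← colorTrace_inter, Finset.inter_comm, colorTrace_inter, ← h₂,
      ← colorTrace_inter])
  have h3 := hz₂ z hz' hz
  have h4 : z ∈ colorTrace c I' E₁ := by
    rw [← h₂]; exact mem_colorTrace.2 ⟨hz', h3⟩
  exact hzI (Finset.mem_inter.2 ⟨hz₁ z (mem_colorTrace.1 h4).1 hz, h3⟩)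

theorem RobustType.adj [DecidableEq α] {I : Finset κ} (hI : RobustType c m F I)
    {E : Finset α} (hE : E ∈ F)
    (hinj : Set.InjOn c (E : Set α)) {x y : α} (hx : x ∈ E) (hy : y ∈ E) (hxy : x ≠ y)
    (h : I = {c x, c y}) : (robustGraph m F).Adj x y := by
  have htr : colorTrace c I E = {x, y} := by
    ext z
    simp only [mem_colorTrace, h, Finset.mem_insert, Finset.mem_singleton]
    constructor
    · rintro ⟨hz, h | h⟩
      · exact Or.inl (hinj hz hx h)
      · exact Or.inr (hinj hz hy h)
    · rintro (rfl | rfl)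
      · exact ⟨hx, Or.inl rfl⟩
      · exact ⟨hy, Or.inr rfl⟩
  refine ⟨hxy, fun Z hZ => ?_⟩
  obtain ⟨E', hE', h', hz⟩ := hI E hE Z hZ
  refine ⟨E', hE', ?_, fun z hz1 hz2 => ?_⟩
  · rw [← htr, ← h']; exact Finset.filter_subset _ _
  · rw [← htr, ← h']; exact mem_colorTrace.2 ⟨hz1, hz z hz1 hz2⟩

/-- If two distinct rainbow edges agree on `P`, the set of colours of their intersection is not
avoided, hence robust, and it contains `P`. -/
theorem exists_robust_superset [DecidableEq α] {P : Finset κ}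
    (hhom : ∀ I, RobustType c m F I ∨ AvoidedType c F I)
    {E E' : Finset α} (hE : E ∈ F) (hE' : E' ∈ F) (hinj : Set.InjOn c (E : Set α))
    (hinj' : Set.InjOn c (E' : Set α)) (hcard : E.card = E'.card) (hne : E ≠ E')
    (hsurj : ∀ i, ∃ z ∈ E, c z = i) (hP : colorTrace c P E = colorTrace c P E') :
    ∃ I, RobustType c m F I ∧ I ≠ Finset.image c E ∧ P ⊆ I := by
  set I := (E ∩ E').image c with hI
  have h1 : colorTrace c I E = E ∩ E' := by
    ext z
    simp only [mem_colorTrace, hI, Finset.mem_image]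
    constructor
    · rintro ⟨hz, w, hw, hwz⟩
      rw [← hinj (Finset.mem_inter.1 hw).1 hz hwz]
      exact hw
    · exact fun hz => ⟨(Finset.mem_inter.1 hz).1, z, hz, rfl⟩
  have h2 : colorTrace c I E' = E ∩ E' := by
    ext z
    simp only [mem_colorTrace, hI, Finset.mem_image]
    constructor
    · rintro ⟨hz, w, hw, hwz⟩
      rw [← hinj' (Finset.mem_inter.1 hw).2 hz hwz]
      exact hw
    · exact fun hz => ⟨(Finset.mem_inter.1 hz).2, z, hz, rfl⟩
  refine ⟨I, (hhom I).resolve_right fun hav => ?_, ?_, ?_⟩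
  · obtain ⟨z, hz, hz', hzI⟩ := hav E hE E' hE' (h1.trans h2.symm)
    exact hzI (Finset.mem_image_of_mem c (Finset.mem_inter.2 ⟨hz, hz'⟩))
  · intro h
    have : colorTrace c I E = E := by
      ext z
      rw [mem_colorTrace, h]
      exact ⟨fun h => h.1, fun h => ⟨h, Finset.mem_image_of_mem c h⟩⟩
    rw [h1] at this
    exact hne (Finset.eq_of_subset_of_card_le (Finset.inter_eq_left.1 this) hcard.ge)
  · intro i hi
    obtain ⟨z, hz, rfl⟩ := hsurj i
    have : z ∈ colorTrace c P E' := hP ▸ mem_colorTrace.2 ⟨hz, hi⟩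
    exact Finset.mem_image_of_mem c (Finset.mem_inter.2 ⟨hz, (mem_colorTrace.1 this).1⟩)

end Homogeneous

theorem exists_spansStar_or_spansTwoEdges_of_homogeneous {α : Type*} [Fintype α] [DecidableEq α]
    {k m : ℕ} (hk : 4 ≤ k) (hkm : k ≤ m) (c : α → Fin k) {F : Finset (Finset α)}
    (hF : (F : Set (Finset α)).Sized k) (hinj : ∀ E ∈ F, Set.InjOn c (E : Set α))
    (hhom : ∀ I, RobustType c m F I ∨ AvoidedType c F I)
    (hcard : Fintype.card α ^ (k - 2) < F.card) :
    ∃ E ∈ F, SpansStar (robustGraph m F) E ∨ SpansTwoEdges (robustGraph m F) E := by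
  have hne : F.Nonempty := Finset.card_pos.1 (by omega)
  have himage : ∀ E ∈ F, E.image c = Finset.univ := by
    intro E hE
    apply Finset.eq_univ_of_card
    rw [Finset.card_image_of_injOn (hinj E hE), hF hE, Fintype.card_fin]
  have hsurj : ∀ E ∈ F, ∀ i, ∃ z ∈ E, c z = i := by
    intro E hE i
    have : i ∈ E.image c := himage E hE ▸ Finset.mem_univ i
    simpa using this
  have hcover : ∀ i j : Fin k, i ≠ j →
      ∃ I ∈ {I | RobustType c m F I}, I ≠ Finset.univ ∧ ({i, j}ᶜ : Finset (Fin k)) ⊆ I := by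
    intro i j hij
    have hmaps : ∀ E ∈ F, colorTrace c {i, j}ᶜ E ∈
        (Finset.univ : Finset α).powersetCard (k - 2) := by
      intro E hE
      rw [Finset.mem_powersetCard]
      refine ⟨Finset.subset_univ _, ?_⟩
      have h1 : (colorTrace c {i, j}ᶜ E).image c = {i, j}ᶜ := by
        ext l
        simp only [Finset.mem_image, mem_colorTrace]
        constructor
        · rintro ⟨z, hz, rfl⟩; exact hz.2
        · intro hl
          obtain ⟨z, hz, rfl⟩ := hsurj E hE l
          exact ⟨z, ⟨hz, hl⟩, rfl⟩
      rw [← Finset.card_image_of_injOn (f := c)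
        ((hinj E hE).mono (by exact_mod_cast Finset.filter_subset _ _)), h1, Finset.card_compl,
        Finset.card_pair hij, Fintype.card_fin]
    obtain ⟨E, hE, E', hE', hEE', htr⟩ := Finset.exists_ne_map_eq_of_card_lt_of_maps_to (by
      rw [Finset.card_powersetCard, Finset.card_univ]
      exact (Nat.choose_le_pow _ _).trans_lt hcard) hmaps
    obtain ⟨I, hI, hIu, hsub⟩ := exists_robust_superset hhom hE hE' (hinj E hE) (hinj E' hE')
      ((hF hE).trans (hF hE').symm) hEE' (hsurj E hE) htr
    exact ⟨I, hI, himage E hE ▸ hIu, hsub⟩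
  obtain ⟨E, hE⟩ := hne
  refine ⟨E, hE, ?_⟩
  choose f hf hcf using hsurj E hE
  have hfne : ∀ {i j}, i ≠ j → f i ≠ f j := fun {i j} hij h => hij (by rw [← hcf i, h, hcf])
  have hadj : ∀ i j : Fin k, i ≠ j → RobustType c m F {i, j} → (robustGraph m F).Adj (f i) (f j) :=
    fun i j hij h => h.adj hE (hinj E hE) (hf i) (hf j) (hfne hij) (by rw [hcf, hcf])
  rcases exists_star_or_two_pairs (J := {I | RobustType c m F I}) (by simpa using hk)
      (fun I hI I' hI' => RobustType.inter (fun E hE => (hF hE).le.trans hkm) ⟨E, hE⟩ hhom hI hI')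
      hcover with ⟨v, hv⟩ | ⟨i, j, p, q, hij, hpq, h1, h2, h3, h4, h5, h6⟩
  · left
    refine ⟨f v, hf v, fun y hy hyv => ?_⟩
    have hy' : y = f (c y) := hinj E hE hy (hf _) (hcf _).symm
    rw [hy']
    have : c y ≠ v := fun h => hyv (by rw [hy', h])
    exact hadj v (c y) this.symm (hv _ this)
  · right
    exact ⟨f i, hf i, f j, hf j, f p, hf p, f q, hf q, hfne h1, hfne h2, hfne h3, hfne h4,
      hadj i j hij h5, hadj p q hpq h6⟩

/-- The constant depends on `k` and `m` only, not on the ground set. -/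
theorem card_le_of_forall_not_spans {k m : ℕ} (hk : 4 ≤ k) (hkm : k ≤ m) :
    ∃ C : ℕ, ∀ {α : Type} [Fintype α] [DecidableEq α] (F : Finset (Finset α)),
      (F : Set (Finset α)).Sized k →
      (∀ E ∈ F, ¬ SpansStar (robustGraph m F) E ∧ ¬ SpansTwoEdges (robustGraph m F) E) →
      F.card ≤ C * Fintype.card α ^ (k - 2) := by
  classical
  refine ⟨k ^ k * (1 + m * Fintype.card (Finset (Fin k))) ^ Fintype.card (Finset (Fin k)), ?_⟩
  intro α _ _ F hF hno
  obtain ⟨c, hc⟩ := exists_rainbow_coloring (by omega : 0 < k) F hF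
  obtain ⟨F', hF', hcard, hhom⟩ := exists_homogeneous c m
    (F.filter fun E : Finset α => Set.InjOn c (E : Set α))
  have hsub : F' ⊆ F := hF'.trans (Finset.filter_subset _ _)
  have h : F'.card ≤ Fintype.card α ^ (k - 2) := by
    by_contra! hlt
    obtain ⟨E, hE, h⟩ := exists_spansStar_or_spansTwoEdges_of_homogeneous hk hkm c
      (fun E hE => hF (hsub hE)) (fun E hE => (Finset.mem_filter.1 (hF' hE)).2) hhom hlt
    rcases h with h | h
    · exact (hno E (hsub hE)).1 (h.mono (robustGraph_mono hsub))
    · exact (hno E (hsub hE)).2 (h.mono (robustGraph_mono hsub))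
  calc F.card ≤ _ := hc
    _ ≤ _ := Nat.mul_le_mul_left _ (hcard.trans (Nat.mul_le_mul_left _ h))
    _ = _ := by ring

/-! ### Embedding forests and their expansions -/

/-- Every nonempty vertex set of a forest contains a vertex with at most one neighbour in the set.
-/
theorem SimpleGraph.IsAcyclic.exists_mem_subsingleton_neighbors {V : Type*} {T : SimpleGraph V}
    (hT : T.IsAcyclic) {S : Finset V} (hS : S.Nonempty) :
    ∃ v ∈ S, ∃ u, ∀ w ∈ S, T.Adj v w → w = u := by
  classical
  rcases hS.exists_eq_singleton_or_nontrivial with ⟨v, rfl⟩ | hnt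
  · exact ⟨v, by simp, v, fun w hw _ => by simpa using hw⟩
  have hne : Nonempty S := hS.to_subtype
  have hnt' : Nontrivial S := hnt.coe_sort
  -- The forest induced on `S` extends to a tree on `S`, which has a leaf.
  obtain ⟨G, hTG, -, hG⟩ :=
    (SimpleGraph.connected_top (V := S)).exists_isTree_le_of_le_of_isAcyclic
      (le_top : T.comap (Subtype.val : S → V) ≤ ⊤) (hT.comap (G := T.comap Subtype.val)
        ⟨Subtype.val, fun h => h⟩ Subtype.val_injective)
  obtain ⟨v, hv⟩ := hG.exists_vert_degree_one_of_nontrivial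
  obtain ⟨u, hu, huniq⟩ := SimpleGraph.degree_eq_one_iff_existsUnique_adj.1 hv
  refine ⟨v, v.2, u, fun w hw hvw => ?_⟩
  exact congrArg Subtype.val (huniq ⟨w, hw⟩ (hTG (show T.Adj v w from hvw)))

/-- Greedy embedding of a forest, adding a leaf or an isolated vertex at each step. -/
theorem exists_embedding_of_forall_exists_adj {V α : Type*} [Fintype V] {T : SimpleGraph V}
    (hT : T.IsAcyclic) (G : SimpleGraph α) {W : Set α} (hW : W.Nonempty)
    (h : ∀ x ∈ W, ∀ Z : Finset α, Z.card < Fintype.card V → ∃ y ∈ W, y ∉ Z ∧ G.Adj x y) :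
    ∃ f : V ↪ α, (∀ v, f v ∈ W) ∧ ∀ u v, T.Adj u v → G.Adj (f u) (f v) := by
  classical
  obtain ⟨w₀, hw₀⟩ := hW
  suffices H : ∀ S : Finset V, ∃ f : V → α, Set.InjOn f S ∧ (∀ v, f v ∈ W) ∧
      ∀ u ∈ S, ∀ v ∈ S, T.Adj u v → G.Adj (f u) (f v) by
    obtain ⟨f, hf, hfW, hadj⟩ := H Finset.univ
    exact ⟨⟨f, fun a b hab => hf (by simp) (by simp) hab⟩, hfW,
      fun u v => hadj u (by simp) v (by simp)⟩
  intro S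
  induction S using Finset.strongInduction with
  | H S ih =>
  rcases S.eq_empty_or_nonempty with rfl | hS
  · exact ⟨fun _ => w₀, by simp, fun _ => hw₀, by simp⟩
  -- If `v` has no neighbour in `S`, then `u` is arbitrary; placing `v` next to `f u` is harmless.
  obtain ⟨v, hv, u, hu⟩ := hT.exists_mem_subsingleton_neighbors hS
  obtain ⟨f, hf, hfW, hadj⟩ := ih (S.erase v) (Finset.erase_ssubset hv)
  have hcard : ((S.erase v).image f).card < Fintype.card V :=
    Finset.card_image_le.trans_lt ((Finset.card_lt_card (Finset.erase_ssubset hv)).trans_le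
      (Finset.card_le_univ S))
  obtain ⟨y, hyW, hyZ, hy⟩ := h (f u) (hfW u) _ hcard
  have hyne : ∀ w ∈ S, w ≠ v → f w ≠ y := fun w hw hwv hwy =>
    hyZ (Finset.mem_image.2 ⟨w, Finset.mem_erase.2 ⟨hwv, hw⟩, hwy⟩)
  refine ⟨Function.update f v y, ?_, ?_, ?_⟩
  · intro a ha b hb hab
    by_cases hav : a = v <;> by_cases hbv : b = v
    · rw [hav, hbv]
    · rw [hav, Function.update_self, Function.update_of_ne hbv] at hab
      exact absurd hab.symm (hyne b hb hbv)
    · rw [hbv, Function.update_self, Function.update_of_ne hav] at hab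
      exact absurd hab (hyne a ha hav)
    · rw [Function.update_of_ne hav, Function.update_of_ne hbv] at hab
      exact hf (by simpa [hav] using ha) (by simpa [hbv] using hb) hab
  · intro w
    by_cases hwv : w = v
    · rw [hwv, Function.update_self]; exact hyW
    · rw [Function.update_of_ne hwv]; exact hfW w
  · intro a ha b hb hab
    by_cases hav : a = v <;> by_cases hbv : b = v
    · exact absurd (hav.trans hbv.symm) hab.ne
    · subst hav
      obtain rfl := hu b hb hab
      rw [Function.update_self, Function.update_of_ne hbv]
      exact hy.symm
    · subst hbv
      obtain rfl := hu a ha hab.symm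
      rw [Function.update_self, Function.update_of_ne hav]
      exact hy
    · rw [Function.update_of_ne hav, Function.update_of_ne hbv]
      exact hadj a (by simpa [hav] using ha) b (by simpa [hbv] using hb) hab

open Classical in
/-- A `d`-degenerate graph spans at most `d * W.card` edges in `W`. -/
theorem sum_degree_le_of_forall_exists_le {α : Type*} (G : SimpleGraph α) {d : ℕ}
    (h : ∀ W : Finset α, W.Nonempty → ∃ x ∈ W, (W.filter fun y => G.Adj x y).card ≤ d)
    (W : Finset α) : ∑ x ∈ W, (W.filter fun y => G.Adj x y).card ≤ 2 * d * W.card := by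
  induction W using Finset.strongInduction with
  | H W ih =>
  rcases W.eq_empty_or_nonempty with rfl | hW
  · simp
  obtain ⟨v, hv, hd⟩ := h W hW
  have hih := ih (W.erase v) (Finset.erase_ssubset hv)
  have hstep : ∀ x ∈ W.erase v, (W.filter fun y => G.Adj x y).card
      = ((W.erase v).filter fun y => G.Adj x y).card + if G.Adj v x then 1 else 0 := by
    intro x _
    conv_lhs => rw [← Finset.insert_erase hv, Finset.filter_insert]
    by_cases hvx : G.Adj v x
    · rw [if_pos hvx.symm, if_pos hvx, Finset.card_insert_of_notMem (by simp)]
    · rw [if_neg (fun h => hvx h.symm), if_neg hvx, add_zero]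
  rw [← Finset.add_sum_erase _ _ hv, Finset.sum_congr rfl hstep, Finset.sum_add_distrib,
    ← Finset.card_filter]
  have h1 : ((W.erase v).filter fun x => G.Adj v x).card ≤ d :=
    (Finset.card_le_card (Finset.filter_subset_filter _ (Finset.erase_subset v W))).trans hd
  have h2 : W.card = (W.erase v).card + 1 := (Finset.card_erase_add_one hv).symm
  rw [h2, mul_add]
  omega

open Classical in
theorem sum_degree_le_of_no_embedding {V α : Type*} [Fintype V] [Fintype α] {T : SimpleGraph V}
    (hT : T.IsAcyclic) (G : SimpleGraph α)
    (h : ¬ ∃ f : V ↪ α, ∀ u v, T.Adj u v → G.Adj (f u) (f v)) :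
    ∑ x, (Finset.univ.filter fun y => G.Adj x y).card
      ≤ 2 * Fintype.card V * Fintype.card α := by
  refine sum_degree_le_of_forall_exists_le G (fun W hW => ?_) Finset.univ
  by_contra! hcon
  obtain ⟨f, -, hf⟩ := exists_embedding_of_forall_exists_adj hT G (W := (W : Set α)) (by simpa)
    (fun x hx Z hZ => by
      obtain ⟨y, hy, hyZ⟩ := Finset.exists_mem_notMem_of_card_lt_card
        (hZ.trans (hcon x hx))
      rw [Finset.mem_filter] at hy
      exact ⟨y, hy.1, hyZ, hy.2⟩)
  exact h ⟨f, hf⟩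

open Classical in
/-- Given a robust set `K e` for each edge `e` of `T`, such that these sets meet only in images of
vertices of `T`, replace them one at a time by edges of `F` that meet everything else in `K e` only.
-/
theorem exists_edges_of_kernels {V α : Type*} [Fintype V] {T : SimpleGraph V}
    {k m : ℕ} {F : Finset (Finset α)} (hF : (F : Set (Finset α)).Sized k)
    (hm : Fintype.card V + k * Fintype.card T.edgeSet ≤ m) (f : V ↪ α) (K : T.edgeSet → Finset α)
    (hV : ∀ e v, f v ∈ K e → v ∈ (e : Sym2 V))
    (hdisj : ∀ e e', e ≠ e' → ∀ x ∈ K e, x ∈ K e' → ∃ v, f v = x)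
    (hrob : ∀ e, RobustKernel m F (K e)) :
    ∃ A : T.edgeSet → Finset α, (∀ e, A e ∈ F) ∧ (∀ e, K e ⊆ A e) ∧
      (∀ e v, f v ∈ A e → v ∈ (e : Sym2 V)) ∧
      ∀ e e', e ≠ e' → ∀ x ∈ A e, x ∈ A e' → ∃ v, f v = x := by
  suffices H : ∀ S : Finset T.edgeSet, ∃ A : T.edgeSet → Finset α, (∀ e ∈ S, A e ∈ F) ∧
      (∀ e, (A e).card ≤ k) ∧ (∀ e, K e ⊆ A e) ∧
      (∀ e v, f v ∈ A e → v ∈ (e : Sym2 V)) ∧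
      ∀ e e', e ≠ e' → ∀ x ∈ A e, x ∈ A e' → ∃ v, f v = x by
    obtain ⟨A, h1, -, h2⟩ := H Finset.univ
    exact ⟨A, fun e => h1 e (Finset.mem_univ e), h2⟩
  intro S
  induction S using Finset.induction_on with
  | empty =>
    refine ⟨K, by simp, fun e => ?_, fun e => subset_rfl, hV, hdisj⟩
    obtain ⟨E, hE, hKE, -⟩ := hrob e ∅ (by simp)
    exact (Finset.card_le_card hKE).trans (hF hE).le
  | insert e S _ ih =>
    obtain ⟨A, hA, hcard, hKA, hAV, hAd⟩ := ih
    obtain ⟨E, hE, hKE, hEZ⟩ := hrob e (Finset.univ.image f ∪ Finset.univ.biUnion A) (by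
      refine (Finset.card_union_le _ _).trans (le_trans (add_le_add ?_ ?_) hm)
      · exact Finset.card_image_le
      · rw [mul_comm]
        exact Finset.card_biUnion_le_card_mul _ _ _ fun e _ => hcard e)
    have hcross : ∀ e', e ≠ e' → ∀ x ∈ E, x ∈ A e' → ∃ v, f v = x := by
      intro e' hee' x hx hx'
      refine hAd e e' hee' x (hKA e (hEZ x hx ?_)) hx'
      exact Finset.mem_union_right _ (Finset.mem_biUnion.2 ⟨e', Finset.mem_univ _, hx'⟩)
    refine ⟨Function.update A e E, ?_, ?_, ?_, ?_, ?_⟩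
    · intro e' he'
      by_cases h : e' = e
      · rw [h, Function.update_self]; exact hE
      · rw [Function.update_of_ne h]
        exact hA e' ((Finset.mem_insert.1 he').resolve_left h)
    · intro e'
      by_cases h : e' = e
      · rw [h, Function.update_self]; exact (hF hE).le
      · rw [Function.update_of_ne h]; exact hcard e'
    · intro e'
      by_cases h : e' = e
      · rw [h, Function.update_self]; exact hKE
      · rw [Function.update_of_ne h]; exact hKA e'
    · intro e' v
      by_cases h : e' = e
      · rw [h, Function.update_self]
        intro hv
        exact hV e v (hEZ _ hv (Finset.mem_union_left _ (Finset.mem_image_of_mem f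
          (Finset.mem_univ v))))
      · rw [Function.update_of_ne h]; exact hAV e' v
    · intro e₁ e₂ hne x hx₁ hx₂
      by_cases h₁ : e₁ = e <;> by_cases h₂ : e₂ = e
      · exact absurd (h₁.trans h₂.symm) hne
      · rw [h₁, Function.update_self] at hx₁
        rw [Function.update_of_ne h₂] at hx₂
        exact hcross e₂ (Ne.symm h₂) x hx₁ hx₂
      · rw [h₂, Function.update_self] at hx₂
        rw [Function.update_of_ne h₁] at hx₁
        exact hcross e₁ (Ne.symm h₁) x hx₂ hx₁
      · rw [Function.update_of_ne h₁] at hx₁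
        rw [Function.update_of_ne h₂] at hx₂
        exact hAd e₁ e₂ hne x hx₁ hx₂

theorem mem_expansionEdge_inl {V : Type*} {T : SimpleGraph V} {k : ℕ} {e : T.edgeSet} {v : V} :
    (Sum.inl v : V ⊕ T.edgeSet × Fin (k - 2)) ∈ expansionEdge T k e ↔ v ∈ (e : Sym2 V) := by
  classical
  simp [expansionEdge]

theorem mem_expansionEdge_inr {V : Type*} {T : SimpleGraph V} {k : ℕ} {e e' : T.edgeSet}
    {i : Fin (k - 2)} :
    (Sum.inr (e', i) : V ⊕ T.edgeSet × Fin (k - 2)) ∈ expansionEdge T k e ↔ e' = e := by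
  classical
  simp [expansionEdge, eq_comm]

open Classical in
/-- A copy of the expansion from the images `f v` of the vertices of `T` and the edges `A e` of the
copy: the new vertices of `e` are mapped to the points of `A e` that are not images of vertices. -/
theorem containsCopy_of_edges {V α : Type*} {T : SimpleGraph V} {k : ℕ}
    {F : Finset (Finset α)} (hF : (F : Set (Finset α)).Sized k) (f : V ↪ α)
    (A : T.edgeSet → Finset α) (hA : ∀ e, A e ∈ F)
    (hfA : ∀ e : T.edgeSet, ∀ v ∈ (e : Sym2 V), f v ∈ A e)
    (hV : ∀ e v, f v ∈ A e → v ∈ (e : Sym2 V))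
    (hdisj : ∀ e e', e ≠ e' → ∀ x ∈ A e, x ∈ A e' → ∃ v, f v = x) :
    ContainsCopy F (kExpansion T k) := by
  have hcard : ∀ e : T.edgeSet, (A e \ (e : Sym2 V).toFinset.map f).card = k - 2 := by
    intro e
    rw [Finset.card_sdiff_of_subset, Finset.card_map,
      Sym2.card_toFinset_of_not_isDiag _ (T.not_isDiag_of_mem_edgeSet e.2), hF (hA e)]
    intro x hx
    obtain ⟨v, hv, rfl⟩ := Finset.mem_map.1 hx
    exact hfA e v (Sym2.mem_toFinset.1 hv)
  let g : ∀ e : T.edgeSet, (A e \ (e : Sym2 V).toFinset.map f : Finset α) ≃ Fin (k - 2) := fun e =>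
    Finset.equivFinOfCardEq (hcard e)
  have hg : ∀ e i, ((g e).symm i : α) ∈ A e := fun e i =>
    (Finset.mem_sdiff.1 ((g e).symm i).2).1
  have hgf : ∀ e i v, ((g e).symm i : α) ≠ f v := by
    intro e i v h
    refine (Finset.mem_sdiff.1 ((g e).symm i).2).2 ?_
    rw [h]
    exact Finset.mem_map_of_mem f (Sym2.mem_toFinset.2 (hV e v (h ▸ hg e i)))
  let φ : V ⊕ T.edgeSet × Fin (k - 2) → α := Sum.elim f fun p => (g p.1).symm p.2
  have hφ : Function.Injective φ := by
    rintro (u | ⟨e, i⟩) (v | ⟨e', j⟩) h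
    · exact congrArg Sum.inl (f.injective h)
    · exact absurd h.symm (hgf e' j u)
    · exact absurd h (hgf e i v)
    · by_cases hee : e = e'
      · subst hee
        have : i = j := (g e).symm.injective (Subtype.ext h)
        rw [this]
      · have h' : ((g e).symm i : α) = (g e').symm j := h
        obtain ⟨v, hv⟩ := hdisj e e' hee _ (hg e i) (h' ▸ hg e' j)
        exact absurd hv.symm (hgf e i v)
  refine ⟨⟨φ, hφ⟩, ?_⟩
  rintro _ ⟨e, rfl⟩
  convert hA e using 1
  ext x
  simp only [Finset.mem_map, Function.Embedding.coeFn_mk]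
  constructor
  · rintro ⟨v | ⟨e', i⟩, h, rfl⟩
    · exact hfA e v (mem_expansionEdge_inl.1 h)
    · rw [mem_expansionEdge_inr] at h
      subst h
      exact hg e' i
  · intro hx
    by_cases hxe : x ∈ (e : Sym2 V).toFinset.map f
    · obtain ⟨v, hv, rfl⟩ := Finset.mem_map.1 hxe
      exact ⟨Sum.inl v, mem_expansionEdge_inl.2 (Sym2.mem_toFinset.1 hv), rfl⟩
    · refine ⟨Sum.inr (e, g e ⟨x, Finset.mem_sdiff.2 ⟨hx, hxe⟩⟩), mem_expansionEdge_inr.2 rfl, ?_⟩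
      simp [φ]

open Classical in
theorem containsCopy_of_kernels {V α : Type*} [Fintype V] {T : SimpleGraph V}
    {k m : ℕ} {F : Finset (Finset α)} (hF : (F : Set (Finset α)).Sized k)
    (hm : Fintype.card V + k * Fintype.card T.edgeSet ≤ m) (f : V ↪ α) (K : T.edgeSet → Finset α)
    (hfK : ∀ e : T.edgeSet, ∀ v ∈ (e : Sym2 V), f v ∈ K e)
    (hV : ∀ e v, f v ∈ K e → v ∈ (e : Sym2 V))
    (hdisj : ∀ e e', e ≠ e' → ∀ x ∈ K e, x ∈ K e' → ∃ v, f v = x)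
    (hrob : ∀ e, RobustKernel m F (K e)) : ContainsCopy F (kExpansion T k) := by
  obtain ⟨A, hA, hKA, hAV, hAd⟩ := exists_edges_of_kernels hF hm f K hV hdisj hrob
  exact containsCopy_of_edges hF f A hA (fun e v hv => hKA e (hfK e v hv)) hAV hAd

open Classical in
theorem containsCopy_of_embedding_robustGraph {V α : Type*} [Fintype V] {T : SimpleGraph V}
    {k m : ℕ} {F : Finset (Finset α)} (hF : (F : Set (Finset α)).Sized k)
    (hm : Fintype.card V + k * Fintype.card T.edgeSet ≤ m)
    (h : ∃ f : V ↪ α, ∀ u v, T.Adj u v → (robustGraph m F).Adj (f u) (f v)) :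
    ContainsCopy F (kExpansion T k) := by
  obtain ⟨f, hf⟩ := h
  refine containsCopy_of_kernels hF hm f (fun e => (e : Sym2 V).toFinset.map f) ?_ ?_ ?_ ?_
  · intro e v hv
    exact Finset.mem_map_of_mem f (Sym2.mem_toFinset.2 hv)
  · intro e v hv
    rw [Finset.mem_map' f] at hv
    exact Sym2.mem_toFinset.1 hv
  · intro e e' _ x hx _
    obtain ⟨v, -, rfl⟩ := Finset.mem_map.1 hx
    exact ⟨v, rfl⟩
  · rintro ⟨e, he⟩
    induction e using Sym2.ind with
    | _ u v =>
      have := (hf u v he).2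
      convert this using 1
      ext x
      simp [eq_comm]

/-! ### Full families and dense common links -/

/-- Every point of every member of `G` can be exchanged for a point outside any given set of `m`
points, without leaving `G`. -/
def IsFull {α : Type*} [DecidableEq α] (m : ℕ) (G : Finset (Finset α)) : Prop :=
  ∀ A ∈ G, ∀ z ∈ A, ∀ Z : Finset α, Z.card ≤ m → ∃ w ∉ Z, insert w (A.erase z) ∈ G

/-- If `G` is not full, some `P` in its shadow is contained in at most `m` members; removing them
reduces the shadow by at least one and the family by at most `m`. -/
theorem exists_isFull_subfamily {α : Type*} [DecidableEq α] {r m : ℕ} (G : Finset (Finset α))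
    (hG : (G : Set (Finset α)).Sized r) (h : m * G.shadow.card < G.card) :
    ∃ G' ⊆ G, G'.Nonempty ∧ IsFull m G' := by
  induction G using Finset.strongInduction with
  | H G ih =>
  by_cases hfull : IsFull m G
  · exact ⟨G, subset_rfl, Finset.card_pos.1 (by omega), hfull⟩
  unfold IsFull at hfull
  push Not at hfull
  obtain ⟨A, hA, z, hz, Z, hZ, hbad⟩ := hfull
  set P := A.erase z with hP
  set B := G.filter fun A' => P ⊆ A' with hB
  have hAB : A ∈ B := Finset.mem_filter.2 ⟨hA, Finset.erase_subset _ _⟩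
  have hBcard : B.card ≤ m := by
    have : B ⊆ Z.image fun w => insert w P := by
      intro A' hA'
      rw [hB, Finset.mem_filter] at hA'
      obtain ⟨w, hw, hwA⟩ : ∃ w ∉ P, insert w P = A' := by
        have h1 : (A' \ P).card = 1 := by
          rw [Finset.card_sdiff_of_subset hA'.2, hG hA'.1, hP, Finset.card_erase_of_mem hz, hG hA]
          have := Finset.card_pos.2 ⟨z, hz⟩
          rw [hG hA] at this
          omega
        obtain ⟨w, hw⟩ := Finset.card_eq_one.1 h1
        refine ⟨w, (Finset.mem_sdiff.1 (hw ▸ Finset.mem_singleton_self w)).2, ?_⟩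
        rw [Finset.insert_eq, ← hw, Finset.sdiff_union_of_subset hA'.2]
      refine Finset.mem_image.2 ⟨w, ?_, hwA⟩
      by_contra hwZ
      exact hbad w hwZ (hwA ▸ hA'.1)
    exact ((Finset.card_le_card this).trans Finset.card_image_le).trans hZ
  have hshadow : (G \ B).shadow ⊆ G.shadow.erase P := by
    intro Q hQ
    refine Finset.mem_erase.2 ⟨?_, Finset.shadow_mono Finset.sdiff_subset hQ⟩
    rintro rfl
    obtain ⟨A', hA', hsub⟩ := Finset.exists_subset_of_mem_shadow hQ
    rw [Finset.mem_sdiff] at hA'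
    exact hA'.2 (Finset.mem_filter.2 ⟨hA'.1, hsub⟩)
  have hPmem : P ∈ G.shadow := Finset.erase_mem_shadow hA hz
  have h1 := Finset.card_le_card hshadow
  rw [Finset.card_erase_of_mem hPmem] at h1
  have h2 : (G \ B).card + B.card = G.card :=
    Finset.card_sdiff_add_card_eq_card (Finset.filter_subset _ _)
  have h3 : 0 < G.shadow.card := Finset.card_pos.2 ⟨P, hPmem⟩
  have h4 : m * (G \ B).shadow.card + m ≤ m * G.shadow.card := by
    rw [← Nat.mul_succ]
    exact Nat.mul_le_mul_left _ (by omega)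
  obtain ⟨G', hG', h'⟩ := ih (G \ B) (Finset.sdiff_ssubset (Finset.filter_subset _ _) ⟨A, hAB⟩)
    (hG.mono (by exact_mod_cast Finset.sdiff_subset)) (by omega)
  exact ⟨G', hG'.trans Finset.sdiff_subset, h'⟩

/-- The forbidden points outside `P` are exchanged one at a time. -/
theorem IsFull.robustKernel {α : Type*} [DecidableEq α] {m : ℕ} {G : Finset (Finset α)}
    (hG : IsFull m G) {A P : Finset α} (hA : A ∈ G) (hPA : P ⊆ A) : RobustKernel m G P := by
  intro Z hZ
  induction hn : ((A \ P) ∩ Z).card generalizing A with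
  | zero =>
    rw [Finset.card_eq_zero] at hn
    refine ⟨A, hA, hPA, fun z hz hzZ => ?_⟩
    by_contra hzP
    have : z ∈ (A \ P) ∩ Z := Finset.mem_inter.2 ⟨Finset.mem_sdiff.2 ⟨hz, hzP⟩, hzZ⟩
    rw [hn] at this
    exact Finset.notMem_empty z this
  | succ n ih =>
    obtain ⟨z, hz⟩ := Finset.card_pos.1 (by omega : 0 < ((A \ P) ∩ Z).card)
    have hz' := hz
    rw [Finset.mem_inter, Finset.mem_sdiff] at hz'
    obtain ⟨w, hwZ, hw⟩ := hG A hA z hz'.1.1 Z hZ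
    refine ih hw (fun p hp => Finset.mem_insert_of_mem (Finset.mem_erase.2 ⟨?_, hPA hp⟩)) ?_
    · rintro rfl; exact hz'.1.2 hp
    · have : (insert w (A.erase z) \ P) ∩ Z = ((A \ P) ∩ Z).erase z := by
        ext x
        simp only [Finset.mem_inter, Finset.mem_sdiff, Finset.mem_insert, Finset.mem_erase]
        constructor
        · rintro ⟨⟨rfl | h, h1⟩, h2⟩
          · exact absurd h2 hwZ
          · exact ⟨h.1, ⟨h.2, h1⟩, h2⟩
        · rintro ⟨h, ⟨h1, h2⟩, h3⟩
          exact ⟨⟨Or.inr ⟨h, h1⟩, h2⟩, h3⟩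
      rw [this, Finset.card_erase_of_mem hz, hn]
      rfl

theorem IsFull.exists_embedding {V α : Type*} [Fintype V] [DecidableEq α] {T : SimpleGraph V}
    (hT : T.IsAcyclic) {m r : ℕ} (hr : 2 ≤ r) (hm : Fintype.card V ≤ m) {G : Finset (Finset α)}
    (hG : IsFull m G) (hsized : (G : Set (Finset α)).Sized r) (hne : G.Nonempty) :
    ∃ f : V ↪ α, (∀ v, ∃ A ∈ G, f v ∈ A) ∧ ∀ u v, T.Adj u v → ∃ A ∈ G, f u ∈ A ∧ f v ∈ A := by
  obtain ⟨A₀, hA₀⟩ := hne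
  obtain ⟨x₀, hx₀⟩ := Finset.card_pos.1 (by rw [hsized hA₀]; omega : 0 < A₀.card)
  obtain ⟨f, hf, hadj⟩ := exists_embedding_of_forall_exists_adj hT (robustGraph m G)
    (W := {x | ∃ A ∈ G, x ∈ A}) ⟨x₀, A₀, hA₀, hx₀⟩ (by
      rintro x ⟨A, hA, hx⟩ Z hZ
      obtain ⟨A', hA', hxA', hA'Z⟩ :=
        hG.robustKernel hA (Finset.singleton_subset_iff.2 hx) Z (by omega)
      rw [Finset.singleton_subset_iff] at hxA'
      obtain ⟨y, hy, hyx⟩ := Finset.exists_mem_ne (by rw [hsized hA']; omega : 1 < A'.card) x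
      refine ⟨y, ⟨A', hA', hy⟩, fun hyZ => hyx (by simpa using hA'Z y hy hyZ), hyx.symm,
        hG.robustKernel hA' ?_⟩
      intro z hz
      rcases Finset.mem_insert.1 hz with rfl | hz
      · exact hxA'
      · rw [Finset.mem_singleton] at hz; exact hz ▸ hy)
  refine ⟨f, hf, fun u v huv => ?_⟩
  obtain ⟨A, hA, hsub, -⟩ := (hadj u v huv).2 ∅ (by simp)
  exact ⟨A, hA, hsub (by simp), hsub (by simp)⟩

/-- The edges of `T ∖ X` are the edges of `T` without an endpoint in `X`. -/
theorem ncard_edgeSet_induce_compl {V : Type*} (T : SimpleGraph V) (X : Set V) :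
    (T.induce Xᶜ).edgeSet.ncard
      = Nat.card {e : T.edgeSet // ∀ v ∈ (e : Sym2 V), v ∉ X} := by
  rw [← Nat.card_coe_set_eq]
  refine Nat.card_congr (Equiv.ofBijective (fun e => ⟨⟨Sym2.map Subtype.val e.1, ?_⟩, ?_⟩) ⟨?_, ?_⟩)
  · obtain ⟨e, he⟩ := e
    induction e using Sym2.ind with
    | _ u v => exact he
  · intro v hv
    obtain ⟨w, -, rfl⟩ := Sym2.mem_map.1 hv
    exact w.2
  · intro e e' h
    simp only [Subtype.mk.injEq] at h
    exact Subtype.ext (Sym2.map.injective Subtype.val_injective h)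
  · rintro ⟨⟨e, he⟩, hX⟩
    induction e using Sym2.ind with
    | _ u v =>
      exact ⟨⟨s(⟨u, hX u (by simp)⟩, ⟨v, hX v (by simp)⟩), he⟩, by simp⟩

open Classical in
/-- The forest is embedded in the pairs covered by `G`. Then the vertices of `X` are moved to points
of `Y`, and each edge of `T ∖ X` receives a point of `Y` of its own as one of its new vertices. In
this way each edge of `T` is assigned exactly one point of `Y`, and the rest of it is robust in `G`.
-/
theorem containsCopy_of_isFull_link {V α : Type*} [Fintype V] {T : SimpleGraph V}
    (hT : T.IsAcyclic) {X : Finset V} (hX : T.IsIndepSet (X : Set V)) {k m : ℕ} (hk : 3 ≤ k)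
    (hm : Fintype.card V + k * Fintype.card T.edgeSet ≤ m)
    {F G : Finset (Finset α)} (hF : (F : Set (Finset α)).Sized k)
    (hsized : (G : Set (Finset α)).Sized (k - 1)) (hG : IsFull m G) (hne : G.Nonempty)
    {Y : Finset α} (hY : X.card + (T.induce ((X : Set V)ᶜ)).edgeSet.ncard ≤ Y.card)
    (hGY : ∀ A ∈ G, ∀ x ∈ A, x ∉ Y) (hGF : ∀ A ∈ G, ∀ y ∈ Y, insert y A ∈ F) :
    ContainsCopy F (kExpansion T k) := by
  obtain ⟨f₀, hf₀, hadj⟩ := hG.exists_embedding hT (by omega : 2 ≤ k - 1) (by omega) hsized hne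
  have hf₀Y : ∀ v, f₀ v ∉ Y := fun v =>
    let ⟨A, hA, hv⟩ := hf₀ v
    hGY A hA _ hv
  rw [ncard_edgeSet_induce_compl, Nat.card_eq_fintype_card] at hY
  obtain ⟨β⟩ : Nonempty
      ((X ⊕ {e : T.edgeSet // ∀ v ∈ (e : Sym2 V), v ∉ (X : Set V)}) ↪ Y) :=
    Function.Embedding.nonempty_of_card_le (by simpa using hY)
  have hβ : ∀ {p q}, (β p : α) = β q → p = q := fun h => β.injective (Subtype.ext h)
  -- Under `β` the points of `Y` serve the vertices of `X` and the edges of `T ∖ X`.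
  let f : V → α := fun v => if h : v ∈ X then β (Sum.inl ⟨v, h⟩) else f₀ v
  have hfX : ∀ v (h : v ∈ X), f v = β (Sum.inl ⟨v, h⟩) := fun v h => dif_pos h
  have hfX' : ∀ v, v ∉ X → f v = f₀ v := fun v h => dif_neg h
  have hf : Function.Injective f := by
    intro u v h
    by_cases hu : u ∈ X <;> by_cases hv : v ∈ X
    · rw [hfX u hu, hfX v hv] at h
      simpa using hβ h
    · rw [hfX u hu, hfX' v hv] at h
      exact absurd (h ▸ (β _).2) (hf₀Y v)
    · rw [hfX v hv, hfX' u hu] at h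
      exact absurd (h ▸ (β _).2) (hf₀Y u)
    · rw [hfX' u hu, hfX' v hv] at h
      exact f₀.injective h
  -- `ψ e` is the endpoint of `e` in `X` if there is one, and `e` itself otherwise; `β (ψ e)` is the
  -- point of `Y` in the copy of `e`, and `P e` consists of the images of the endpoints outside `X`.
  have hψ : ∀ e : T.edgeSet, ∃ p : X ⊕ {e : T.edgeSet // ∀ v ∈ (e : Sym2 V), v ∉ (X : Set V)},
      (∃ x : X, p = Sum.inl x ∧ (x : V) ∈ (e : Sym2 V)) ∨
        ∃ h : ∀ v ∈ (e : Sym2 V), v ∉ (X : Set V), p = Sum.inr ⟨e, h⟩ := by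
    intro e
    by_cases h : ∀ v ∈ (e : Sym2 V), v ∉ (X : Set V)
    · exact ⟨Sum.inr ⟨e, h⟩, Or.inr ⟨h, rfl⟩⟩
    · push Not at h
      obtain ⟨v, hv, hvX⟩ := h
      exact ⟨Sum.inl ⟨v, hvX⟩, Or.inl ⟨_, rfl, hv⟩⟩
  choose ψ hψ using hψ
  let P : T.edgeSet → Finset α := fun e =>
    ((e : Sym2 V).toFinset.filter fun v => v ∉ X).map f₀
  have hP : ∀ {e x}, x ∈ P e ↔ ∃ v ∈ (e : Sym2 V), v ∉ X ∧ f₀ v = x := by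
    intro e x
    simp [P, and_assoc]
  have hPY : ∀ {e x}, x ∈ P e → x ∉ Y := by
    intro e x hx
    obtain ⟨v, -, -, rfl⟩ := hP.1 hx
    exact hf₀Y v
  refine containsCopy_of_kernels hF hm ⟨f, hf⟩
    (fun e => insert (β (ψ e) : α) (P e)) ?_ ?_ ?_ ?_
  · intro e v hv
    simp only [Function.Embedding.coeFn_mk]
    by_cases hvX : v ∈ X
    · rcases hψ e with ⟨x, hx, hxe⟩ | ⟨h, -⟩
      · have : v = x := by
          by_contra hne
          refine hX hvX x.2 hne ?_
          have he : (e : Sym2 V) = s(v, (x : V)) := ((Sym2.mem_and_mem_iff hne).1 ⟨hv, hxe⟩)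
          have := e.2
          rwa [he, SimpleGraph.mem_edgeSet] at this
        subst this
        rw [hfX _ hvX, hx]
        exact Finset.mem_insert_self _ _
      · exact absurd hvX (h v hv)
    · rw [hfX' v hvX]
      exact Finset.mem_insert_of_mem (hP.2 ⟨v, hv, hvX, rfl⟩)
  · intro e v hv
    simp only [Function.Embedding.coeFn_mk] at hv
    rcases Finset.mem_insert.1 hv with h | h
    · by_cases hvX : v ∈ X
      · rw [hfX v hvX] at h
        have h' := hβ h
        rcases hψ e with ⟨x, hx, hxe⟩ | ⟨h, hx⟩
        · rw [hx, Sum.inl.injEq] at h'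
          rw [← h'] at hxe
          exact hxe
        · rw [hx] at h'
          cases h'
      · rw [hfX' v hvX] at h
        exact absurd (h ▸ (β _).2) (hf₀Y v)
    · by_cases hvX : v ∈ X
      · rw [hfX v hvX] at h
        exact absurd (β _).2 (hPY h)
      · rw [hfX' v hvX] at h
        obtain ⟨u, hu, -, huv⟩ := hP.1 h
        rwa [← f₀.injective huv]
  · intro e e' hee x hx hx'
    have hPf : ∀ e, x ∈ P e → ∃ v, (⟨f, hf⟩ : V ↪ α) v = x := by
      intro e h
      obtain ⟨v, -, hvX, hv⟩ := hP.1 h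
      exact ⟨v, (hfX' v hvX).trans hv⟩
    rcases Finset.mem_insert.1 hx with h | h
    · rcases Finset.mem_insert.1 hx' with h' | h'
      · have := hβ (h.symm.trans h')
        rcases hψ e with ⟨y, hy, -⟩ | ⟨h1, h2⟩
        · exact ⟨y, (hfX y y.2).trans (by rw [h, hy])⟩
        · rcases hψ e' with ⟨y, hy, -⟩ | ⟨h3, h4⟩
          · rw [h2, hy] at this
            cases this
          · rw [h2, h4, Sum.inr.injEq, Subtype.mk.injEq] at this
            exact absurd this hee
      · exact hPf e' h'
    · exact hPf e h
  · intro e Z hZ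
    obtain ⟨A, hA, hPA⟩ : ∃ A ∈ G, P e ⊆ A := by
      obtain ⟨e, he⟩ := e
      induction e using Sym2.ind with
      | _ u v =>
        obtain ⟨A, hA, hu, hv⟩ := hadj u v he
        refine ⟨A, hA, fun x hx => ?_⟩
        obtain ⟨w, hw, -, rfl⟩ := hP.1 hx
        rcases Sym2.mem_iff.1 hw with rfl | rfl
        · exact hu
        · exact hv
    obtain ⟨A', hA', hPA', hA'Z⟩ := hG.robustKernel hA hPA Z hZ
    refine ⟨insert (β (ψ e) : α) A', hGF A' hA' _ (β _).2, Finset.insert_subset_insert _ hPA', ?_⟩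
    intro z hz hzZ
    rcases Finset.mem_insert.1 hz with rfl | h
    · exact Finset.mem_insert_self _ _
    · exact Finset.mem_insert_of_mem (hA'Z z h hzZ)

/-! ### Counting the edges of a family without the expansion -/

section Counting

variable {α : Type*} [Fintype α] [DecidableEq α] {k : ℕ} {F : Finset (Finset α)}

theorem card_filter_superset_le (hF : (F : Set (Finset α)).Sized k) (P : Finset α) :
    (F.filter fun E => P ⊆ E).card ≤ Fintype.card α ^ (k - P.card) := by
  refine le_trans ?_ (Nat.choose_le_pow (Fintype.card α) (k - P.card))
  rw [← Finset.card_univ (α := α), ← Finset.card_powersetCard]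
  refine Finset.card_le_card_of_injOn (fun E => E \ P) ?_ ?_
  · intro E hE
    have hE' := Finset.mem_filter.1 (Finset.mem_coe.1 hE)
    rw [Finset.mem_coe, Finset.mem_powersetCard, Finset.card_sdiff_of_subset hE'.2, hF hE'.1]
    exact ⟨Finset.subset_univ _, rfl⟩
  · intro E hE E' hE' h
    have h1 := (Finset.mem_filter.1 (Finset.mem_coe.1 hE)).2
    have h2 := (Finset.mem_filter.1 (Finset.mem_coe.1 hE')).2
    rw [← Finset.sdiff_union_of_subset h1, ← Finset.sdiff_union_of_subset h2]
    exact congrArg (· ∪ P) h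

open Classical in
theorem card_filter_spansTwoEdges_le (hk : 4 ≤ k) (hF : (F : Set (Finset α)).Sized k)
    (G : SimpleGraph α) {t : ℕ}
    (ht : ∑ x, (Finset.univ.filter fun y => G.Adj x y).card ≤ t * Fintype.card α) :
    (F.filter fun E => SpansTwoEdges G E).card ≤ t ^ 2 * Fintype.card α ^ (k - 2) := by
  set D : Finset (Σ _ : α, α) := Finset.univ.sigma fun x => Finset.univ.filter fun y => G.Adj x y
    with hD
  have hDcard : D.card ≤ t * Fintype.card α := by
    rw [hD, Finset.card_sigma]; exact ht
  set Q := (D ×ˢ D).filter fun p =>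
    p.1.1 ≠ p.2.1 ∧ p.1.1 ≠ p.2.2 ∧ p.1.2 ≠ p.2.1 ∧ p.1.2 ≠ p.2.2 with hQ
  have hQcard : Q.card ≤ (t * Fintype.card α) ^ 2 := by
    refine (Finset.card_filter_le _ _).trans ?_
    rw [Finset.card_product, sq]
    exact Nat.mul_le_mul hDcard hDcard
  have hsub : (F.filter fun E => SpansTwoEdges G E) ⊆ Q.biUnion fun p =>
      F.filter fun E => ({p.1.1, p.1.2, p.2.1, p.2.2} : Finset α) ⊆ E := by
    intro E hE
    obtain ⟨hEF, a, ha, b, hb, c, hc, d, hd, h1, h2, h3, h4, h5, h6⟩ := Finset.mem_filter.1 hE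
    refine Finset.mem_biUnion.2 ⟨(⟨a, b⟩, ⟨c, d⟩), ?_, ?_⟩
    · simp [hQ, hD, h1, h2, h3, h4, h5, h6]
    · rw [Finset.mem_filter]
      refine ⟨hEF, ?_⟩
      simp [Finset.insert_subset_iff, ha, hb, hc, hd]
  calc _ ≤ _ := Finset.card_le_card hsub
    _ ≤ Q.card * Fintype.card α ^ (k - 4) := by
      refine Finset.card_biUnion_le_card_mul _ _ _ fun p hp => ?_
      obtain ⟨⟨a, b⟩, ⟨c, d⟩⟩ := p
      simp only [hQ, hD, Finset.mem_filter, Finset.mem_product, Finset.mem_sigma,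
        Finset.mem_univ, true_and] at hp
      obtain ⟨⟨hab, hcd⟩, h1, h2, h3, h4⟩ := hp
      have hc4 : ({a, b, c, d} : Finset α).card = 4 := by
        rw [Finset.card_insert_of_notMem (by simp [hab.ne, h1, h2]),
          Finset.card_insert_of_notMem (by simp [h3, h4]), Finset.card_pair hcd.ne]
      have := card_filter_superset_le hF {a, b, c, d}
      rwa [hc4] at this
    _ ≤ (t * Fintype.card α) ^ 2 * Fintype.card α ^ (k - 4) := Nat.mul_le_mul_right _ hQcard
    _ = t ^ 2 * Fintype.card α ^ (k - 2) := by
      rw [mul_pow, mul_assoc, ← pow_add]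
      congr 3
      omega

theorem card_filter_one_lt_inter_le (hF : (F : Set (Finset α)).Sized k) (L : Finset α) :
    (F.filter fun E => 1 < (E ∩ L).card).card ≤ L.card ^ 2 * Fintype.card α ^ (k - 2) := by
  have hsub : (F.filter fun E => 1 < (E ∩ L).card) ⊆
      L.offDiag.biUnion fun p => F.filter fun E => ({p.1, p.2} : Finset α) ⊆ E := by
    intro E hE
    obtain ⟨hEF, h⟩ := Finset.mem_filter.1 hE
    obtain ⟨a, ha, b, hb, hab⟩ := Finset.one_lt_card.1 h
    rw [Finset.mem_inter] at ha hb
    refine Finset.mem_biUnion.2 ⟨(a, b), Finset.mem_offDiag.2 ⟨ha.2, hb.2, hab⟩, ?_⟩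
    rw [Finset.mem_filter]
    refine ⟨hEF, ?_⟩
    simp [Finset.insert_subset_iff, ha.1, hb.1]
  calc _ ≤ _ := Finset.card_le_card hsub
    _ ≤ L.offDiag.card * Fintype.card α ^ (k - 2) := by
      refine Finset.card_biUnion_le_card_mul _ _ _ fun p hp => ?_
      have := card_filter_superset_le hF {p.1, p.2}
      rwa [Finset.card_pair (Finset.mem_offDiag.1 hp).2.2] at this
    _ ≤ _ := by
      refine Nat.mul_le_mul_right _ ?_
      rw [Finset.offDiag_card, sq]
      exact Nat.sub_le _ _

open Classical in
/-- The sets with a spanning star whose centre `x` has degree `d x ≤ n / q` number at most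
`∑ x, d x ^ (k - 1) ≤ (n / q) ^ (k - 2) * ∑ x, d x`. -/
theorem mul_card_filter_low_star_le (hk : 2 ≤ k) (hF : (F : Set (Finset α)).Sized k)
    (G : SimpleGraph α) {t q : ℕ}
    (ht : ∑ x, (Finset.univ.filter fun y => G.Adj x y).card ≤ t * Fintype.card α) :
    q ^ (k - 2) * (F.filter fun E => ∃ x ∈ E,
        q * (Finset.univ.filter fun y => G.Adj x y).card ≤ Fintype.card α ∧
        ∀ y ∈ E, y ≠ x → G.Adj x y).card
      ≤ t * Fintype.card α ^ (k - 1) := by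
  set N : α → Finset α := fun x => Finset.univ.filter fun y => G.Adj x y with hN
  set B := Finset.univ.filter fun x => q * (N x).card ≤ Fintype.card α with hB
  have hsub : (F.filter fun E => ∃ x ∈ E, q * (N x).card ≤ Fintype.card α ∧
        ∀ y ∈ E, y ≠ x → G.Adj x y) ⊆
      B.biUnion fun x => ((N x).powersetCard (k - 1)).image (insert x) := by
    intro E hE
    obtain ⟨hEF, x, hx, hlow, hstar⟩ := Finset.mem_filter.1 hE
    refine Finset.mem_biUnion.2 ⟨x, by simp [hB, hlow], Finset.mem_image.2 ⟨E.erase x, ?_,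
      Finset.insert_erase hx⟩⟩
    rw [Finset.mem_powersetCard, Finset.card_erase_of_mem hx, hF hEF]
    refine ⟨fun y hy => ?_, rfl⟩
    rw [Finset.mem_erase] at hy
    simp [hN, hstar y hy.2 hy.1]
  have hterm : ∀ x ∈ B, q ^ (k - 2) * (((N x).powersetCard (k - 1)).image (insert x)).card
      ≤ Fintype.card α ^ (k - 2) * (N x).card := by
    intro x hx
    have hx' : q * (N x).card ≤ Fintype.card α := (Finset.mem_filter.1 hx).2
    calc _ ≤ q ^ (k - 2) * (N x).card ^ (k - 1) := by
          refine Nat.mul_le_mul_left _ (Finset.card_image_le.trans ?_)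
          rw [Finset.card_powersetCard]
          exact Nat.choose_le_pow _ _
      _ = (q * (N x).card) ^ (k - 2) * (N x).card := by
          rw [mul_pow, mul_assoc, ← pow_succ]
          congr 2
          omega
      _ ≤ _ := Nat.mul_le_mul_right _ (Nat.pow_le_pow_left hx' _)
  calc _ ≤ q ^ (k - 2) * ∑ x ∈ B, (((N x).powersetCard (k - 1)).image (insert x)).card :=
        Nat.mul_le_mul_left _ ((Finset.card_le_card hsub).trans Finset.card_biUnion_le)
    _ ≤ ∑ x ∈ B, Fintype.card α ^ (k - 2) * (N x).card := by
        rw [Finset.mul_sum]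
        exact Finset.sum_le_sum hterm
    _ ≤ ∑ x, Fintype.card α ^ (k - 2) * (N x).card :=
        Finset.sum_le_sum_of_subset (Finset.subset_univ _)
    _ ≤ Fintype.card α ^ (k - 2) * (t * Fintype.card α) := by
        rw [← Finset.mul_sum]
        exact Nat.mul_le_mul_left _ ht
    _ = t * Fintype.card α ^ (k - 1) := by
        rw [mul_left_comm, ← pow_succ]
        congr 2
        omega

/-- Edges meeting `L` in one point, counted by the rest `S` of the edge: either at most `s` points
of `L` complete `S`, or `S` lies in the common link of some `s + 1` points of `L`. -/
theorem card_filter_inter_eq_one_le (hF : (F : Set (Finset α)).Sized k) (L : Finset α)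
    {s b : ℕ} (hb : ∀ Y ∈ L.powersetCard (s + 1),
      ((Lᶜ.powersetCard (k - 1)).filter fun S => ∀ y ∈ Y, insert y S ∈ F).card ≤ b) :
    (F.filter fun E => (E ∩ L).card = 1).card
      ≤ s * (Fintype.card α).choose (k - 1) + L.card * (2 ^ L.card * b) := by
  set 𝒮 := Lᶜ.powersetCard (k - 1) with h𝒮
  set X : Finset α → Finset α := fun S => L.filter fun x => insert x S ∈ F with hX
  set R := 𝒮.filter fun S => s < (X S).card with hR
  have hsub : (F.filter fun E => (E ∩ L).card = 1) ⊆
      𝒮.biUnion fun S => (X S).image fun x => insert x S := by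
    intro E hE
    obtain ⟨hEF, h⟩ := Finset.mem_filter.1 hE
    obtain ⟨x, hx⟩ := Finset.card_eq_one.1 h
    have hx' : x ∈ E ∩ L := hx ▸ Finset.mem_singleton_self x
    rw [Finset.mem_inter] at hx'
    refine Finset.mem_biUnion.2 ⟨E.erase x, ?_, Finset.mem_image.2 ⟨x, ?_,
      Finset.insert_erase hx'.1⟩⟩
    · rw [h𝒮, Finset.mem_powersetCard, Finset.card_erase_of_mem hx'.1, hF hEF]
      refine ⟨fun y hy => ?_, rfl⟩
      rw [Finset.mem_erase] at hy
      rw [Finset.mem_compl]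
      intro hyL
      have : y ∈ E ∩ L := Finset.mem_inter.2 ⟨hy.2, hyL⟩
      rw [hx, Finset.mem_singleton] at this
      exact hy.1 this
    · rw [hX, Finset.mem_filter, Finset.insert_erase hx'.1]
      exact ⟨hx'.2, hEF⟩
  have hRcard : R.card ≤ 2 ^ L.card * b := by
    have hRsub : R ⊆ (L.powersetCard (s + 1)).biUnion fun Y =>
        𝒮.filter fun S => ∀ y ∈ Y, insert y S ∈ F := by
      intro S hS
      obtain ⟨hS1, hS2⟩ := Finset.mem_filter.1 hS
      obtain ⟨Y, hYX, hY⟩ := Finset.exists_subset_card_eq (Nat.succ_le_of_lt hS2)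
      refine Finset.mem_biUnion.2 ⟨Y, Finset.mem_powersetCard.2
        ⟨hYX.trans (Finset.filter_subset _ _), hY⟩, Finset.mem_filter.2 ⟨hS1, fun y hy => ?_⟩⟩
      exact (Finset.mem_filter.1 (hYX hy)).2
    calc R.card ≤ _ := Finset.card_le_card hRsub
      _ ≤ (L.powersetCard (s + 1)).card * b := Finset.card_biUnion_le_card_mul _ _ _ hb
      _ ≤ _ := by
        refine Nat.mul_le_mul_right _ ?_
        rw [Finset.card_powersetCard]
        exact Nat.choose_le_two_pow _ _
  calc _ ≤ _ := Finset.card_le_card hsub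
    _ ≤ ∑ S ∈ 𝒮, (X S).card :=
      Finset.card_biUnion_le.trans (Finset.sum_le_sum fun S _ => Finset.card_image_le)
    _ ≤ ∑ S ∈ 𝒮, (s + if s < (X S).card then L.card else 0) := by
      refine Finset.sum_le_sum fun S _ => ?_
      split_ifs with h
      · exact (Finset.card_le_card (Finset.filter_subset _ _)).trans (Nat.le_add_left _ _)
      · omega
    _ = 𝒮.card * s + R.card * L.card := by
      rw [Finset.sum_add_distrib, ← Finset.sum_filter, Finset.sum_const, Finset.sum_const,
        smul_eq_mul, smul_eq_mul]
    _ ≤ _ := by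
      refine add_le_add ?_ ?_
      · rw [mul_comm]
        refine Nat.mul_le_mul_left _ ?_
        rw [h𝒮, Finset.card_powersetCard]
        exact Nat.choose_le_choose _ (Finset.card_le_univ _)
      · rw [mul_comm]
        exact Nat.mul_le_mul_left _ hRcard

end Counting

theorem exists_isIndepSet_forestSigma {V : Type*} [Fintype V] (T : SimpleGraph V) :
    ∃ X : Finset V, T.IsIndepSet (X : Set V) ∧
      forestSigma T = X.card + (T.induce ((X : Set V)ᶜ)).edgeSet.ncard :=
  Nat.sInf_mem (s := {m : ℕ | ∃ X : Finset V, T.IsIndepSet (X : Set V) ∧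
    m = X.card + (T.induce ((X : Set V)ᶜ)).edgeSet.ncard}) ⟨_, ∅, by simp, rfl⟩

theorem forestSigma_le {V : Type*} [Fintype V] (T : SimpleGraph V) {X : Finset V}
    (hX : T.IsIndepSet (X : Set V)) :
    forestSigma T ≤ X.card + (T.induce ((X : Set V)ᶜ)).edgeSet.ncard :=
  Nat.sInf_le ⟨X, hX, rfl⟩

theorem forestSigma_pos {V : Type*} [Fintype V] {T : SimpleGraph V} (h : T.edgeSet.Nonempty) :
    0 < forestSigma T := by
  classical
  obtain ⟨X, -, hσ⟩ := exists_isIndepSet_forestSigma T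
  rw [hσ]
  by_contra! hcon
  have h0 : X = ∅ := Finset.card_eq_zero.1 (by omega)
  subst h0
  have h1 : (T.induce (((∅ : Finset V) : Set V)ᶜ)).edgeSet.ncard = 0 := by omega
  rw [ncard_edgeSet_induce_compl, Finite.card_eq_zero_iff] at h1
  obtain ⟨e, he⟩ := h
  exact h1.false ⟨⟨e, he⟩, by simp⟩

open Classical in
/-- A set of `σ(T)` points has few common links outside `L`. -/
theorem card_common_link_le {V α : Type*} [Fintype V] [Fintype α] {T : SimpleGraph V}
    (hT : T.IsAcyclic) {k m : ℕ} (hk : 3 ≤ k)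
    (hm : Fintype.card V + k * Fintype.card T.edgeSet ≤ m)
    {F : Finset (Finset α)} (hF : (F : Set (Finset α)).Sized k)
    (hfree : ¬ ContainsCopy F (kExpansion T k)) {L Y : Finset α} (hYL : Y ⊆ L)
    (hY : forestSigma T ≤ Y.card) :
    ((Lᶜ.powersetCard (k - 1)).filter fun S => ∀ y ∈ Y, insert y S ∈ F).card
      ≤ m * Fintype.card α ^ (k - 2) := by
  set G := (Lᶜ.powersetCard (k - 1)).filter fun S => ∀ y ∈ Y, insert y S ∈ F with hG
  have hsized : (G : Set (Finset α)).Sized (k - 1) := fun A hA =>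
    (Finset.mem_powersetCard.1 (Finset.mem_filter.1 (Finset.mem_coe.1 hA)).1).2
  have hshadow : G.shadow.card ≤ Fintype.card α ^ (k - 2) := by
    have h1 : G.shadow ⊆ (Finset.univ : Finset α).powersetCard (k - 2) := fun Q hQ =>
      Finset.mem_powersetCard.2 ⟨Finset.subset_univ _, hsized.shadow hQ⟩
    refine (Finset.card_le_card h1).trans ?_
    rw [Finset.card_powersetCard, Finset.card_univ]
    exact Nat.choose_le_pow _ _
  by_contra! hcon
  obtain ⟨G', hG', hne, hfull⟩ := exists_isFull_subfamily G hsized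
    ((Nat.mul_le_mul_left _ hshadow).trans_lt hcon)
  obtain ⟨X, hX, hσ⟩ := exists_isIndepSet_forestSigma T
  refine hfree (containsCopy_of_isFull_link hT hX hk hm hF
    (hsized.mono (by exact_mod_cast hG')) hfull hne (Y := Y) (hσ ▸ hY) ?_ ?_)
  · intro A hA x hx hxY
    have := (Finset.mem_powersetCard.1 (Finset.mem_filter.1 (hG' hA)).1).1 hx
    exact Finset.mem_compl.1 this (hYL hxY)
  · exact fun A hA => (Finset.mem_filter.1 (hG' hA)).2

open Classical in
/-- The upper bound for a single family, with a parameter `q` that makes the term of order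
`n ^ (k - 1)` negligible. The constant `C` depends on `T`, `k` and `q`, not on the ground set. -/
theorem exists_mul_card_le_of_not_containsCopy {V : Type*} [Fintype V] {T : SimpleGraph V}
    (hT : T.IsAcyclic) (hedge : T.edgeSet.Nonempty) {k : ℕ} (hk : 4 ≤ k) (q : ℕ) :
    ∃ C : ℕ, ∀ {α : Type} [Fintype α] (F : Finset (Finset α)), (F : Set (Finset α)).Sized k →
      ¬ ContainsCopy F (kExpansion T k) →
      q * F.card ≤ q * ((forestSigma T - 1) * (Fintype.card α).choose (k - 1))
        + 2 * Fintype.card V * Fintype.card α ^ (k - 1) + C * Fintype.card α ^ (k - 2) := by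
  set m := Fintype.card V + k * Fintype.card T.edgeSet with hm
  have hkm : k ≤ m := by
    have : 0 < Fintype.card T.edgeSet := Fintype.card_pos_iff.2 hedge.to_subtype
    calc k = k * 1 := (mul_one k).symm
      _ ≤ k * Fintype.card T.edgeSet := Nat.mul_le_mul_left _ this
      _ ≤ m := Nat.le_add_left _ _
  obtain ⟨C₀, hC₀⟩ := card_le_of_forall_not_spans hk hkm
  set t := 2 * Fintype.card V with ht
  refine ⟨q * (C₀ + t ^ 2 + (q * t) ^ 2 + q * t * (2 ^ (q * t) * m)), ?_⟩
  intro α _ F hF hfree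
  set n := Fintype.card α with hn
  set G := robustGraph m F with hG
  have hdeg : ∑ x, (Finset.univ.filter fun y => G.Adj x y).card ≤ t * n :=
    sum_degree_le_of_no_embedding hT G fun h =>
      hfree (containsCopy_of_embedding_robustGraph hF le_rfl h)
  set L := Finset.univ.filter fun x => n < q * (Finset.univ.filter fun y => G.Adj x y).card with hL
  have hLcard : L.card ≤ q * t := by
    rcases Nat.eq_zero_or_pos n with h0 | h0
    · have := Finset.card_le_univ L
      omega
    · refine Nat.le_of_mul_le_mul_right (c := n) ?_ h0
      calc L.card * n ≤ ∑ x ∈ L, q * (Finset.univ.filter fun y => G.Adj x y).card :=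
            Finset.card_nsmul_le_sum _ _ _ fun x hx => (Finset.mem_filter.1 hx).2.le
        _ ≤ ∑ x, q * (Finset.univ.filter fun y => G.Adj x y).card :=
            Finset.sum_le_sum_of_subset (Finset.subset_univ _)
        _ ≤ q * (t * n) := by
            rw [← Finset.mul_sum]; exact Nat.mul_le_mul_left _ hdeg
        _ = _ := by ring
  -- A star centred in `L` meets `L`, so every edge is of one of the following five kinds.
  set F₀ := F.filter fun E => ¬ SpansStar G E ∧ ¬ SpansTwoEdges G E with hF₀
  set F₁ := F.filter fun E => SpansTwoEdges G E with hF₁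
  set F₂ := F.filter fun E => ∃ x ∈ E, q * (Finset.univ.filter fun y => G.Adj x y).card ≤ n ∧
    ∀ y ∈ E, y ≠ x → G.Adj x y with hF₂
  set F₃ := F.filter fun E => 1 < (E ∩ L).card with hF₃
  set F₄ := F.filter fun E => (E ∩ L).card = 1 with hF₄
  have hcover : F ⊆ F₀ ∪ (F₁ ∪ (F₂ ∪ (F₃ ∪ F₄))) := by
    intro E hE
    simp only [Finset.mem_union, hF₀, hF₁, hF₂, hF₃, hF₄, Finset.mem_filter, hE, true_and]
    by_cases h1 : SpansTwoEdges G E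
    · exact Or.inr (Or.inl h1)
    by_cases h2 : SpansStar G E
    · obtain ⟨x, hx, hstar⟩ := h2
      by_cases hxL : x ∈ L
      · have : 0 < (E ∩ L).card := Finset.card_pos.2 ⟨x, Finset.mem_inter.2 ⟨hx, hxL⟩⟩
        right; right; right
        omega
      · refine Or.inr (Or.inr (Or.inl ⟨x, hx, ?_, hstar⟩))
        simpa [hL] using hxL
    · exact Or.inl ⟨h2, h1⟩
  have h₀ : F₀.card ≤ C₀ * n ^ (k - 2) := by
    refine hC₀ F₀ (fun E hE => hF (Finset.filter_subset _ _ hE)) fun E hE => ?_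
    have h := (Finset.mem_filter.1 hE).2
    have hmono := robustGraph_mono (m := m) (Finset.filter_subset
      (fun E => ¬ SpansStar G E ∧ ¬ SpansTwoEdges G E) F)
    exact ⟨fun h' => h.1 (h'.mono hmono), fun h' => h.2 (h'.mono hmono)⟩
  have h₁ : F₁.card ≤ t ^ 2 * n ^ (k - 2) := card_filter_spansTwoEdges_le hk hF G hdeg
  have h₂ : q * F₂.card ≤ t * n ^ (k - 1) :=
    (Nat.mul_le_mul_right _ (Nat.le_self_pow (by omega) q)).trans
      (mul_card_filter_low_star_le (by omega) hF G hdeg)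
  have h₃ : F₃.card ≤ (q * t) ^ 2 * n ^ (k - 2) :=
    (card_filter_one_lt_inter_le hF L).trans
      (Nat.mul_le_mul_right _ (Nat.pow_le_pow_left hLcard 2))
  have h₄ : F₄.card ≤ (forestSigma T - 1) * n.choose (k - 1)
      + q * t * (2 ^ (q * t) * (m * n ^ (k - 2))) := by
    refine (card_filter_inter_eq_one_le hF L (s := forestSigma T - 1) (b := m * n ^ (k - 2))
      fun Y hY => ?_).trans ?_
    · rw [Finset.mem_powersetCard] at hY
      exact card_common_link_le hT (by omega) le_rfl hF hfree hY.1 (by omega)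
    · gcongr
      norm_num
  have hsum : F.card ≤ F₀.card + (F₁.card + (F₂.card + (F₃.card + F₄.card))) :=
    (Finset.card_le_card hcover).trans <| (Finset.card_union_le _ _).trans <|
      Nat.add_le_add_left ((Finset.card_union_le _ _).trans <|
        Nat.add_le_add_left ((Finset.card_union_le _ _).trans <|
          Nat.add_le_add_left (Finset.card_union_le _ _) _) _) _
  calc q * F.card ≤ q * (F₀.card + (F₁.card + (F₂.card + (F₃.card + F₄.card)))) :=
        Nat.mul_le_mul_left _ hsum
    _ = q * F₀.card + q * F₁.card + q * F₂.card + q * F₃.card + q * F₄.card := by ring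
    _ ≤ q * (C₀ * n ^ (k - 2)) + q * (t ^ 2 * n ^ (k - 2)) + t * n ^ (k - 1)
        + q * ((q * t) ^ 2 * n ^ (k - 2)) + q * ((forestSigma T - 1) * n.choose (k - 1)
      + q * t * (2 ^ (q * t) * (m * n ^ (k - 2)))) := by gcongr
    _ = _ := by ring

/-! ### The cross-cut family and the asymptotics of the Turán number -/

open Classical in
theorem not_containsCopy_crossCutFamily {V : Type*} [Fintype V] (T : SimpleGraph V) {k n : ℕ}
    {Y : Finset (Fin n)} (hY : Y.card < forestSigma T) :
    ¬ ContainsCopy (crossCutFamily k n Y) (kExpansion T k) := by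
  rintro ⟨f, hf⟩
  have hone : ∀ e : T.edgeSet, ((expansionEdge T k e).map f ∩ Y).card = 1 := fun e =>
    (Finset.mem_filter.1 (hf _ ⟨e, rfl⟩)).2
  set X : Finset V := Finset.univ.filter fun v => f (Sum.inl v) ∈ Y with hX
  have hXY : ∀ v, v ∈ X ↔ f (Sum.inl v) ∈ Y := by simp [hX]
  have hind : T.IsIndepSet (X : Set V) := by
    intro u hu v hv huv hadj
    have hmem : ∀ w ∈ s(u, v), w ∈ X →
        f (Sum.inl w) ∈ (expansionEdge T k ⟨s(u, v), hadj⟩).map f ∩ Y := fun w hw hwX =>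
      Finset.mem_inter.2 ⟨Finset.mem_map_of_mem f (mem_expansionEdge_inl.2 hw), (hXY w).1 hwX⟩
    have := Finset.card_le_one.1 (hone ⟨s(u, v), hadj⟩).le _ (hmem u (by simp) hu) _
      (hmem v (by simp) hv)
    exact huv (Sum.inl_injective (f.injective this))
  have hnew : ∀ d : {e : T.edgeSet // ∀ v ∈ (e : Sym2 V), v ∉ (X : Set V)},
      ∃ i, f (Sum.inr (d.1, i)) ∈ Y := by
    rintro ⟨e, he⟩
    obtain ⟨y, hy⟩ := Finset.card_pos.1 (hone e ▸ Nat.one_pos)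
    obtain ⟨hy1, hy2⟩ := Finset.mem_inter.1 hy
    obtain ⟨v | ⟨e', i⟩, h, rfl⟩ := Finset.mem_map.1 hy1
    · exact absurd ((hXY v).2 hy2) (he v (mem_expansionEdge_inl.1 h))
    · rw [mem_expansionEdge_inr] at h
      subst h
      exact ⟨i, hy2⟩
  choose i hi using hnew
  let g : X ⊕ {e : T.edgeSet // ∀ v ∈ (e : Sym2 V), v ∉ (X : Set V)} → Y :=
    Sum.elim (fun v => ⟨f (Sum.inl v), (hXY v).1 v.2⟩) fun d => ⟨_, hi d⟩
  have hg : Function.Injective g := by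
    rintro (u | d) (v | d') h
    · have := f.injective (congrArg Subtype.val h)
      rw [Sum.inl.injEq] at this
      rw [Subtype.ext this]
    · have := f.injective (congrArg Subtype.val h)
      cases this
    · have := f.injective (congrArg Subtype.val h)
      cases this
    · have := f.injective (congrArg Subtype.val h)
      rw [Sum.inr.injEq, Prod.mk.injEq] at this
      rw [Subtype.ext this.1]
  have hcard := Fintype.card_le_of_injective g hg
  rw [Fintype.card_sum, Fintype.card_coe, Fintype.card_coe, ← Nat.card_eq_fintype_card,
    ← ncard_edgeSet_induce_compl] at hcard
  have := forestSigma_le T hind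
  omega

theorem card_crossCutFamily {k n : ℕ} (hk : 1 ≤ k) (Y : Finset (Fin n)) :
    (crossCutFamily k n Y).card = Y.card * (n - Y.card).choose (k - 1) := by
  have himage : crossCutFamily k n Y
      = (Y ×ˢ Yᶜ.powersetCard (k - 1)).image fun p => insert p.1 p.2 := by
    ext E
    simp only [crossCutFamily, Finset.mem_filter, Finset.mem_powersetCard, Finset.subset_univ,
      true_and, Finset.mem_image, Finset.mem_product, Prod.exists]
    constructor
    · rintro ⟨hE, h⟩
      obtain ⟨x, hx⟩ := Finset.card_eq_one.1 h
      have hx' : x ∈ E ∩ Y := hx ▸ Finset.mem_singleton_self x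
      rw [Finset.mem_inter] at hx'
      refine ⟨x, E.erase x, ⟨hx'.2, fun y hy => ?_, ?_⟩, Finset.insert_erase hx'.1⟩
      · rw [Finset.mem_erase] at hy
        rw [Finset.mem_compl]
        intro hyY
        have : y ∈ E ∩ Y := Finset.mem_inter.2 ⟨hy.2, hyY⟩
        rw [hx, Finset.mem_singleton] at this
        exact hy.1 this
      · rw [Finset.card_erase_of_mem hx'.1, hE]
    · rintro ⟨x, S, ⟨hx, hSY, hS⟩, rfl⟩
      have hdisj : S ∩ Y = ∅ := by
        rw [← Finset.disjoint_iff_inter_eq_empty]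
        exact Finset.subset_compl_iff_disjoint_right.1 hSY
      have hxS : x ∉ S := fun h => Finset.mem_compl.1 (hSY h) hx
      refine ⟨by rw [Finset.card_insert_of_notMem hxS, hS]; omega, ?_⟩
      rw [Finset.insert_inter_of_mem hx, hdisj]
      simp
  rw [himage, Finset.card_image_of_injOn, Finset.card_product, Finset.card_powersetCard,
    Finset.card_compl, Fintype.card_fin]
  rintro ⟨x, S⟩ h ⟨x', S'⟩ h' heq
  rw [Finset.mem_coe, Finset.mem_product, Finset.mem_powersetCard] at h h'
  have heq' : insert x S = insert x' S' := heq
  have hnot : ∀ {y}, y ∈ Y → y ∉ S ∧ y ∉ S' := fun hy =>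
    ⟨fun hs => Finset.mem_compl.1 (h.2.1 hs) hy, fun hs => Finset.mem_compl.1 (h'.2.1 hs) hy⟩
  have hxx : x = x' := by
    have : x ∈ insert x' S' := heq' ▸ Finset.mem_insert_self x S
    exact (Finset.mem_insert.1 this).resolve_right (hnot h.1).2
  subst hxx
  rw [Prod.mk.injEq]
  refine ⟨rfl, ?_⟩
  rw [← Finset.erase_insert (hnot h.1).1, heq', Finset.erase_insert (hnot h.1).2]

theorem card_le_hypergraphTuranNumber {k n : ℕ} {W : Type*} {H : Set (Finset W)}
    {F : Finset (Finset (Fin n))} (hF : (F : Set (Finset (Fin n))).Sized k)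
    (hfree : ¬ ContainsCopy F H) : F.card ≤ hypergraphTuranNumber k n H := by
  classical
  unfold hypergraphTuranNumber
  exact Finset.le_sup (f := Finset.card) (Finset.mem_filter.2 ⟨Finset.mem_univ _, hF, hfree⟩)

theorem card_crossCutFamily_le_hypergraphTuranNumber {V : Type*} [Fintype V] (T : SimpleGraph V)
    {k n : ℕ} {Y : Finset (Fin n)} (hY : Y.card < forestSigma T) :
    (crossCutFamily k n Y).card ≤ hypergraphTuranNumber k n (kExpansion T k) :=
  card_le_hypergraphTuranNumber
    (fun _ hE => (Finset.mem_powersetCard.1 (Finset.mem_filter.1 (Finset.mem_coe.1 hE)).1).2)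
    (not_containsCopy_crossCutFamily T hY)

theorem exists_mul_hypergraphTuranNumber_le {V : Type*} [Fintype V] {T : SimpleGraph V}
    (hT : T.IsAcyclic) (hedge : T.edgeSet.Nonempty) {k : ℕ} (hk : 4 ≤ k) {q : ℕ} (hq : 0 < q) :
    ∃ C : ℕ, ∀ n : ℕ, q * hypergraphTuranNumber k n (kExpansion T k)
      ≤ q * ((forestSigma T - 1) * n.choose (k - 1))
        + 2 * Fintype.card V * n ^ (k - 1) + C * n ^ (k - 2) := by
  classical
  obtain ⟨C, hC⟩ := exists_mul_card_le_of_not_containsCopy hT hedge hk q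
  refine ⟨C, fun n => ?_⟩
  rw [mul_comm q (hypergraphTuranNumber _ _ _), ← Nat.le_div_iff_mul_le hq]
  unfold hypergraphTuranNumber
  refine Finset.sup_le fun F hF => ?_
  obtain ⟨-, hsized, hfree⟩ := Finset.mem_filter.1 hF
  rw [Nat.le_div_iff_mul_le hq, mul_comm]
  simpa using hC F hsized hfree

theorem choose_le_choose_sub_add (n a r : ℕ) :
    n.choose (r + 1) ≤ (n - a).choose (r + 1) + a * n ^ r := by
  induction a with
  | zero => simp
  | succ a ih =>
    have h : (n - a).choose (r + 1) ≤ (n - (a + 1)).choose (r + 1) + n ^ r := by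
      rcases Nat.eq_zero_or_pos (n - a) with h0 | h0
      · rw [h0]; simp
      · obtain ⟨l, hl⟩ := Nat.exists_eq_succ_of_ne_zero h0.ne'
        rw [show n - (a + 1) = l by omega, hl, Nat.succ_eq_add_one, Nat.choose_succ_succ', add_comm]
        have : l.choose r ≤ n ^ r :=
          (Nat.choose_le_pow l r).trans (Nat.pow_le_pow_left (by omega) r)
        omega
    rw [add_mul, one_mul]
    omega

theorem hypergraphTuranNumber_kExpansion_sub_isLittleO {V : Type*} [Fintype V] {T : SimpleGraph V}
    (hT : T.IsAcyclic) (hedge : T.edgeSet.Nonempty) {k : ℕ} (hk : 4 ≤ k) :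
    (fun n : ℕ => (hypergraphTuranNumber k n (kExpansion T k) : ℝ)
        - ((forestSigma T : ℝ) - 1) * (n.choose (k - 1) : ℝ))
      =o[atTop] fun n : ℕ => (n.choose (k - 1) : ℝ) := by
  obtain ⟨a, ha⟩ := Nat.exists_eq_succ_of_ne_zero (forestSigma_pos hedge).ne'
  have haσ : (forestSigma T : ℝ) - 1 = a := by rw [ha]; push_cast; ring
  obtain ⟨B, hB0, hB⟩ := (isTheta_choose (k - 1)).2.exists_pos
  rw [haσ, isLittleO_iff]
  intro ε hε
  -- The choice of `q` makes the term of order `n ^ (k - 1)` at most `ε * q * n.choose (k - 1)`,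
  -- with the additional `+ 1` to absorb the term of order `n ^ (k - 2)`.
  obtain ⟨q, hq⟩ := exists_nat_gt ((2 * Fintype.card V + 1) * B / ε)
  have hq0 : (0 : ℝ) < q := lt_of_le_of_lt (by positivity) hq
  rw [div_lt_iff₀ hε] at hq
  obtain ⟨C, hC⟩ := exists_mul_hypergraphTuranNumber_le hT hedge hk (Nat.cast_pos.1 hq0)
  obtain ⟨N, hN⟩ := exists_nat_gt (a * a * B / ε)
  rw [div_lt_iff₀ hε] at hN
  filter_upwards [hB.bound, eventually_ge_atTop C, eventually_ge_atTop a, eventually_ge_atTop N,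
    eventually_gt_atTop 0] with n hBn hCn han hNn hn0
  set c : ℝ := (n.choose (k - 1) : ℝ) with hc
  have hc0 : 0 ≤ c := Nat.cast_nonneg _
  have hpow : (n : ℝ) ^ (k - 1) = n ^ (k - 2) * n := by
    rw [← pow_succ]; congr 1; omega
  have hBn' : (n : ℝ) ^ (k - 1) ≤ B * c := by
    rwa [Real.norm_of_nonneg (by positivity), Real.norm_of_nonneg hc0] at hBn
  rw [Real.norm_of_nonneg hc0, Real.norm_eq_abs, abs_le]
  constructor
  · obtain ⟨Y, -, hY⟩ := Finset.exists_subset_card_eq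
      (by simpa using han : a ≤ (Finset.univ : Finset (Fin n)).card)
    have h1 := card_crossCutFamily_le_hypergraphTuranNumber T (k := k) (Y := Y) (by omega)
    rw [card_crossCutFamily (by omega), hY] at h1
    have h2 := choose_le_choose_sub_add n a (k - 2)
    rw [show k - 2 + 1 = k - 1 by omega] at h2
    have h1' : (a : ℝ) * ((n - a).choose (k - 1) : ℕ)
        ≤ hypergraphTuranNumber k n (kExpansion T k) := by
      exact_mod_cast h1
    have h2' : c ≤ ((n - a).choose (k - 1) : ℕ) + a * (n : ℝ) ^ (k - 2) := by
      rw [hc]; exact_mod_cast h2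
    have h3 : (a : ℝ) * a * (n : ℝ) ^ (k - 2) ≤ ε * c := by
      have hn : (0 : ℝ) < n := by exact_mod_cast hn0
      refine le_of_mul_le_mul_right ?_ hn
      calc (a : ℝ) * a * (n : ℝ) ^ (k - 2) * n = a * a * n ^ (k - 1) := by rw [hpow]; ring
        _ ≤ a * a * (B * c) := by gcongr
        _ = a * a * B * c := by ring
        _ ≤ n * ε * c := mul_le_mul_of_nonneg_right (hN.le.trans (by gcongr)) hc0
        _ = _ := by ring
    have h4 : (a : ℝ) * c ≤ a * (((n - a).choose (k - 1) : ℕ) + a * (n : ℝ) ^ (k - 2)) := by gcongr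
    nlinarith
  · have h1 := hC n
    rw [ha, Nat.succ_sub_one] at h1
    have h2 : (q : ℝ) * hypergraphTuranNumber k n (kExpansion T k)
        ≤ q * (a * c) + 2 * Fintype.card V * n ^ (k - 1) + C * n ^ (k - 2) := by
      rw [hc]; exact_mod_cast h1
    have h3 : (C : ℝ) * n ^ (k - 2) ≤ n ^ (k - 1) := by
      rw [hpow, mul_comm]
      gcongr
    have h4 : (2 * Fintype.card V + 1) * (n : ℝ) ^ (k - 1)
        ≤ (2 * Fintype.card V + 1) * (B * c) := by gcongr
    have h5 : (2 * Fintype.card V + 1) * B * c ≤ q * ε * c := by gcongr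
    refine le_of_mul_le_mul_left ?_ hq0
    linarith

theorem theorem4p1 {V : Type*} [Fintype V] (T : SimpleGraph V) (hT : T.IsAcyclic)
    (hedge : T.edgeSet.Nonempty) (k : ℕ) (hk : 4 ≤ k) :
    ((fun n : ℕ => (hypergraphTuranNumber k n (kExpansion T k) : ℝ)
        - ((forestSigma T : ℝ) - 1) * (n.choose (k - 1) : ℝ))
      =o[atTop] fun n : ℕ => (n.choose (k - 1) : ℝ)) ∧
    ∀ (n : ℕ) (Y : Finset (Fin n)), Y.card + 1 = forestSigma T →
      ¬ ContainsCopy (crossCutFamily k n Y) (kExpansion T k) ∧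
      (crossCutFamily k n Y).card = (forestSigma T - 1) * (n - (forestSigma T - 1)).choose (k - 1) ∧
      (crossCutFamily k n Y).card ≤ hypergraphTuranNumber k n (kExpansion T k) := by
  refine ⟨hypergraphTuranNumber_kExpansion_sub_isLittleO hT hedge hk, fun n Y hY => ?_⟩
  refine ⟨not_containsCopy_crossCutFamily T (by omega), ?_,
    card_crossCutFamily_le_hypergraphTuranNumber T (by omega)⟩
  rw [card_crossCutFamily (by omega), ← hY, Nat.add_sub_cancel]
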